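/- Let $r\ge 0$ and let $\lambda=(\lambda_1\ge\dots\ge\lambda_r\ge 0)$ and $\mu=(\mu_1\ge\dots\ge\mu_r\ge 0)$ be integer partitions with $\sum_{i=1}^r\lambda_i=\sum_{i=1}^r\mu_i$ and $\sum_{i=1}^t\lambda_i\ge\sum_{i=1}^t\mu_i$ for all $1\le t\le r$. Put $s=\lambda_1$ ($s=0$ if $r=0$), and let $\lambda'_j=\#\{i:\lambda_i\ge j\}$ for $1\le j\le s$. **Canonical matrix.** Ryser's canonical matrix $A=A(\lambda,\mu)$ is the $r\times s$ matrix with entries in $\{0,1\}$ obtained as follows. Start with the matrix whose $i$-th row consists of $\mu_i$ ones placed flush-left. For $j=s,s-1,\dots,1$ in this order, choose the $\lambda'_j$ rows having the largest sums over columns $1,\dots,j$ of the current matrix, breaking ties in favour of rows further south (larger index), and in each chosen row move the rightmost $1$ among columns $1,\dots,j$ to column $j$. The matrix $A$ is *reducible* if there is a nonempty proper subset $S$ of its columns such that the sum of the columns in $S$ and the sum of the columns not in $S$ are both weakly decreasing vectors (i.e. partitions with at most $r$ nonzero parts). **KGR graph.** Let $A^*_{i,j}=A_{i,j}-A_{i+1,j}$,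 where $A_{r+1,j}:=0$. The directed graph $G(\lambda,\mu)$ has as vertices the positions of the nonzero entries of $A^*$, all of which are $\pm1$. Its arcs are: (I) (horizontal) from each $-1$ to the rightmost $1$ to the left of it in the same row; (II) (vertical) from each $1$ to the $-1$ in the same column, if there is one. Connectedness and connected components always refer to the underlying undirected graph. A *source* of a directed graph is a vertex at which no arc ends, a *sink* is a vertex at which no arc starts. **Conservative subtree.** A subgraph $G'$ of $G(\lambda,\mu)$ (a set of vertices and a set of arcs of $G(\lambda,\mu)$ between them) is a *conservative subtree* if it is nonempty, connected and not equal to $G(\lambda,\mu)$; whenever it contains a vertical arc, it contains all vertical arcs of $G(\lambda,\mu)$ in the same column; and at least one of the following holds: - (C.1) $G'$ is a connected component of $G(\lambda,\mu)$; - (C.2) $G'$ has exactly one sink, this sink is a $-1$ in $A^*$, some source of $G'$ is a $1$ in $A^*$ in the same row as the sink, and all other sources of $G'$ are sources of $G(\lambda,\mu)$. **Theorem.** The matrix $A(\lambda,\mu)$ is reducible if and only if $G(\lambda,\mu)$ has a conservative subtree. -/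

import Mathlib

namespace KGR

/-! Rows and columns are numbered from `0`, so that row `i : Fin r` is row `i + 1` of the usual
numbering. A partition with at most `r` nonzero parts is an antitone function `Fin r → ℕ`. -/

/-- The lattice points `(lam, mu)` of the Kostka cone: two partitions with at most `r` parts, of
the same size, with `lam` dominating `mu`. -/
def IsKostkaPair {r : ℕ} (lam mu : Fin r → ℕ) : Prop :=
  Antitone lam ∧ Antitone mu ∧
    (∀ t : Fin r, ∑ i ∈ Finset.Iic t, mu i ≤ ∑ i ∈ Finset.Iic t, lam i) ∧
    ∑ i, lam i = ∑ i, mu i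

/-- The largest part of a partition (`0` for the empty partition, `r = 0`). -/
def firstPart {r : ℕ} (lam : Fin r → ℕ) : ℕ :=
  if h : 0 < r then lam ⟨0, h⟩ else 0

/-- The length of column `j` of the Young diagram of `lam`, i.e. a part of the conjugate
partition. -/
def conjPart {r : ℕ} (lam : Fin r → ℕ) (j : ℕ) : ℕ :=
  (Finset.univ.filter fun i : Fin r => j < lam i).card

/-! ### Ryser's algorithm -/

/-- The `r × s` matrix whose row `i` consists of `mu i` ones placed flush-left. -/
def flushLeft {r : ℕ} (mu : Fin r → ℕ) (s : ℕ) : Matrix (Fin r) (Fin s) ℕ :=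
  fun i c => if (c : ℕ) < mu i then 1 else 0

/-- The sum of row `i` of the submatrix formed by the columns up to and including column `j`. -/
def leftSum {r s : ℕ} (A : Matrix (Fin r) (Fin s) ℕ) (j : Fin s) (i : Fin r) : ℕ :=
  ∑ c ∈ Finset.Iic j, A i c

/-- The `b` rows having the largest sums in the columns up to `j`, where ties are broken in favour
of the rows further south: row `i` is chosen if fewer than `b` rows have priority over it. -/
def chosenRows {r s : ℕ} (A : Matrix (Fin r) (Fin s) ℕ) (j : Fin s) (b : ℕ) : Finset (Fin r) :=
  Finset.univ.filter fun i =>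
    (Finset.univ.filter fun k =>
      leftSum A j i < leftSum A j k ∨ (leftSum A j k = leftSum A j i ∧ i < k)).card < b

/-- Entry `(i, c)` is the rightmost `1` of row `i` among the columns up to `j`. -/
def IsLastOne {r s : ℕ} (A : Matrix (Fin r) (Fin s) ℕ) (j : Fin s) (i : Fin r) (c : Fin s) : Prop :=
  c ≤ j ∧ A i c = 1 ∧ ∀ d, c < d → d ≤ j → A i d ≠ 1

instance {r s : ℕ} (A : Matrix (Fin r) (Fin s) ℕ) (j : Fin s) (i : Fin r) (c : Fin s) :
    Decidable (IsLastOne A j i c) := by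
  unfold IsLastOne; infer_instance

/-- One step of Ryser's algorithm: in each of the `b` chosen rows, the rightmost `1` among the
columns up to `j` is moved to column `j`. -/
def shiftStep {r s : ℕ} (A : Matrix (Fin r) (Fin s) ℕ) (j : Fin s) (b : ℕ) :
    Matrix (Fin r) (Fin s) ℕ :=
  fun i c =>
    if i ∈ chosenRows A j b then
      if c = j then 1 else if IsLastOne A j i c then 0 else A i c
    else A i c

/-- The matrix after `k` steps of Ryser's algorithm; the step leading from `k` to `k + 1` fills the
`(k + 1)`-st column from the right. -/
def ryserStage {r : ℕ} (lam mu : Fin r → ℕ) : ℕ → Matrix (Fin r) (Fin (firstPart lam)) ℕ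
  | 0 => flushLeft mu (firstPart lam)
  | k + 1 =>
    if h : k < firstPart lam then
      shiftStep (ryserStage lam mu k) (Fin.rev ⟨k, h⟩)
        (conjPart lam (Fin.rev (⟨k, h⟩ : Fin (firstPart lam))))
    else ryserStage lam mu k

/-- Ryser's canonical matrix. -/
def canonicalMatrix {r : ℕ} (lam mu : Fin r → ℕ) : Matrix (Fin r) (Fin (firstPart lam)) ℕ :=
  ryserStage lam mu (firstPart lam)

/-- A matrix is reducible if, for some nonempty proper subset `S` of its columns, the sum of the
columns in `S` and the sum of the columns not in `S` are both partitions. -/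
def IsReducible {r s : ℕ} (A : Matrix (Fin r) (Fin s) ℕ) : Prop :=
  ∃ S : Finset (Fin s), S.Nonempty ∧ S ≠ Finset.univ ∧
    Antitone (fun i : Fin r => ∑ j ∈ S, A i j) ∧
    Antitone (fun i : Fin r => ∑ j ∈ Sᶜ, A i j)

/-! ### The KGR graph -/

/-- The matrix of differences of consecutive rows, where the row below the last one is zero. -/
def starMatrix {r s : ℕ} (A : Matrix (Fin r) (Fin s) ℕ) : Matrix (Fin r) (Fin s) ℤ :=
  fun i j => (A i j : ℤ) - (if h : (i : ℕ) + 1 < r then (A ⟨i + 1, h⟩ j : ℤ) else 0)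

/-- The matrix `A*` of differences of the canonical matrix. -/
def canonicalStar {r : ℕ} (lam mu : Fin r → ℕ) : Matrix (Fin r) (Fin (firstPart lam)) ℤ :=
  starMatrix (canonicalMatrix lam mu)

/-- The vertices of the KGR graph are the positions `(row, column)` of the nonzero entries
of `A*`. -/
abbrev Vertex {r : ℕ} (lam mu : Fin r → ℕ) : Type :=
  {p : Fin r × Fin (firstPart lam) // canonicalStar lam mu p.1 p.2 ≠ 0}

namespace Vertex

variable {r : ℕ} {lam mu : Fin r → ℕ}

/-- The row of a vertex. -/
def row (u : Vertex lam mu) : Fin r := u.1.1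

/-- The column of a vertex. -/
def col (u : Vertex lam mu) : Fin (firstPart lam) := u.1.2

/-- The entry of `A*` at a vertex. -/
def entry (u : Vertex lam mu) : ℤ := canonicalStar lam mu u.row u.col

end Vertex

/-- Arcs of type (I): from a `-1` to the rightmost `1` to the left of it in the same row. -/
def IsHorizontalArc {r : ℕ} {lam mu : Fin r → ℕ} (u v : Vertex lam mu) : Prop :=
  u.entry = -1 ∧ v.entry = 1 ∧ v.row = u.row ∧ v.col < u.col ∧
    ∀ w : Vertex lam mu, w.entry = 1 → w.row = u.row → w.col < u.col → w.col ≤ v.col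

/-- Arcs of type (II): from a `1` to the `-1` in the same column. -/
def IsVerticalArc {r : ℕ} {lam mu : Fin r → ℕ} (u v : Vertex lam mu) : Prop :=
  u.entry = 1 ∧ v.entry = -1 ∧ v.col = u.col

/-- The Kostka-Gale-Ryser graph. -/
def kgrGraph {r : ℕ} (lam mu : Fin r → ℕ) : Digraph (Vertex lam mu) where
  Adj u v := IsHorizontalArc u v ∨ IsVerticalArc u v

/-! ### Subgraphs of directed graphs -/

/-- A vertex of a directed graph is a source if no arc ends in it. -/
def IsSource {V : Type*} (G : Digraph V) (y : V) : Prop := ∀ x, ¬ G.Adj x y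

/-- A vertex of a directed graph is a sink if no arc starts in it. -/
def IsSink {V : Type*} (G : Digraph V) (x : V) : Prop := ∀ y, ¬ G.Adj x y

/-- A subgraph of a directed graph: a set of vertices, and a set of arcs between them. -/
structure DiSubgraph {V : Type*} (G : Digraph V) where
  /-- The vertices of the subgraph. -/
  verts : Set V
  /-- The arcs of the subgraph. -/
  Adj : V → V → Prop
  adj_sub : ∀ {u v}, Adj u v → G.Adj u v
  left_mem : ∀ {u v}, Adj u v → u ∈ verts
  right_mem : ∀ {u v}, Adj u v → v ∈ verts

namespace DiSubgraph

variable {V : Type*} {G : Digraph V}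

/-- A subgraph as a directed graph on its own vertices. -/
def toDigraph (H : DiSubgraph G) : Digraph H.verts where
  Adj u v := H.Adj u v

/-- A subgraph is connected if it is nonempty and connected as an undirected graph. -/
def IsConnected (H : DiSubgraph G) : Prop := H.toDigraph.toSimpleGraphInclusive.Connected

/-- A subgraph is proper if it is not the whole graph. -/
def IsProper (H : DiSubgraph G) : Prop :=
  ¬ (H.verts = Set.univ ∧ ∀ u v, G.Adj u v → H.Adj u v)

/-- The subgraph is a connected component of the underlying undirected graph of `G`, with all the
arcs of `G` between its vertices. -/
def IsComponent (H : DiSubgraph G) : Prop :=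
  ∃ C : G.toSimpleGraphInclusive.ConnectedComponent, H.verts = C.supp ∧
    ∀ u ∈ H.verts, ∀ v ∈ H.verts, G.Adj u v → H.Adj u v

end DiSubgraph

/-! ### Conservative subtrees -/

/-- With every vertical arc, the subgraph contains all vertical arcs of the KGR graph in the same
column. -/
def VerticallyClosed {r : ℕ} {lam mu : Fin r → ℕ} (H : DiSubgraph (kgrGraph lam mu)) : Prop :=
  ∀ a b c d : Vertex lam mu, H.Adj a b → IsVerticalArc a b → IsVerticalArc c d →
    c.col = a.col → H.Adj c d

/-- Condition (C.2): the subgraph has exactly one sink `t`; it is a `-1`; one source `s` is a `1`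
in the row of `t`, and all other sources are sources of the KGR graph. -/
def SinkSourceCondition {r : ℕ} {lam mu : Fin r → ℕ} (H : DiSubgraph (kgrGraph lam mu)) : Prop :=
  ∃ t : H.verts, IsSink H.toDigraph t ∧ (∀ t', IsSink H.toDigraph t' → t' = t) ∧
    t.1.entry = -1 ∧
    ∃ s : H.verts, IsSource H.toDigraph s ∧ s.1.entry = 1 ∧ s.1.row = t.1.row ∧
      ∀ s', IsSource H.toDigraph s' → s' ≠ s → IsSource (kgrGraph lam mu) s'.1

/-- Conservative subtrees of the KGR graph: connected (in particular nonempty), proper subgraphs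
that are closed under vertical arcs and satisfy (C.1) or (C.2). -/
def IsConservativeSubtree {r : ℕ} {lam mu : Fin r → ℕ}
    (H : DiSubgraph (kgrGraph lam mu)) : Prop :=
  H.IsConnected ∧ H.IsProper ∧ VerticallyClosed H ∧ (H.IsComponent ∨ SinkSourceCondition H)

end KGR

/-! Ryser's algorithm is read from right to left as a process of particles on the rows. When only
the first `j` columns are left, the row sums form a partition `leftShape lam mu j`, and row `x` holds
`excess lam mu j x` particles, its difference of consecutive parts. Column `c` of `A*` is the next
event. By the choice of the rows and the tie-break, it contains at most one `-1`, which lies in an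
empty row `x`, and its `1`s lie in the nearest nonempty rows on the two sides of `x`: two
neighbouring particles merge into one that sits strictly between them, or the northernmost particle
moves up, or a particle disappears. That the algorithm never runs out of boxes is the Gale–Ryser
condition (`GaleRyser.removeTop`). Horizontal arcs follow a particle from birth to death and vertical
arcs pass through an event, so out-degrees are at most one and distinct `-1`s of a row have distinct
partners, the endpoints of their horizontal arcs (`IsHorizontalArc.left_unique`).

A set `S` of columns decomposes `A` if and only if every row of `A*` has a nonnegative sum both over
`S` and over its complement. For a conservative subtree, `S` consists of its columns, which it fills
completely. Each `-1` is matched with its partner, except under `SinkSourceCondition`: there the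
partners of the sink and of the `-1` that points to the exceptional source, if there is one, are exchanged
(`isReducible_of_sinkSourceCondition`).

Conversely, let `A` be reducible. If the graph is disconnected, any component will do. Otherwise a
particle disappears only in the leftmost event. If no `1` lies to the right of a `-1` in the same row,
then a row with a `-1` has only one further nonzero entry, the partner, and `S` cannot separate the
two (`col_mem_iff_of_isHorizontalArc`), so `S` is a union of components, which is impossible. So there
are a `-1` at `t` and a nearest `1` to the right of it in the same row, at `w`. Particles never jump
over one another, so after leaving the row at `w` the particle stays the nearest one on its side of
the row until, at `t`, a particle is born there again, out of it (`reflTransGen_of_nearest`). Hence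
there is a path from `w` to `t`, and the branch above `t`, with the part above `w` cut off, is a
conservative subtree (`subtreeBetween_isConservativeSubtree`). -/

namespace KGR

/-! ### Choosing the largest parts -/

/-- The number of rows that have priority over row `i`: those with a larger part, or with an equal
part and further south. -/
def priorityRank {r : ℕ} (p : Fin r → ℕ) (i : Fin r) : ℕ :=
  (Finset.univ.filter fun k => p i < p k ∨ (p k = p i ∧ i < k)).card

/-- The `b` rows of `p` with the largest parts, ties being broken in favour of the rows further
south. -/
def topRows {r : ℕ} (p : Fin r → ℕ) (b : ℕ) : Finset (Fin r) :=
  Finset.univ.filter fun i => priorityRank p i < b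

lemma mem_topRows {r : ℕ} {p : Fin r → ℕ} {b : ℕ} {i : Fin r} :
    i ∈ topRows p b ↔ priorityRank p i < b := by
  simp [topRows]

lemma priorityRank_lt {r : ℕ} {p : Fin r → ℕ} {i k : Fin r}
    (h : p i < p k ∨ (p k = p i ∧ i < k)) : priorityRank p k < priorityRank p i := by
  apply Finset.card_lt_card
  refine ⟨fun l hl => ?_, fun hsub => ?_⟩
  · simp only [Finset.mem_filter, Finset.mem_univ, true_and] at hl ⊢
    omega
  · have := hsub (show k ∈ Finset.univ.filter _ by simpa using h)
    simp at this

lemma mem_topRows_of_priority {r : ℕ} {p : Fin r → ℕ} {b : ℕ} {i k : Fin r}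
    (hi : i ∈ topRows p b) (h : p i < p k ∨ (p k = p i ∧ i < k)) : k ∈ topRows p b :=
  mem_topRows.2 ((priorityRank_lt h).trans (mem_topRows.1 hi))

lemma priorityRank_lt_card {r : ℕ} (p : Fin r → ℕ) (i : Fin r) : priorityRank p i < r := by
  have : priorityRank p i < (Finset.univ : Finset (Fin r)).card := by
    apply Finset.card_lt_card
    refine ⟨Finset.subset_univ _, fun hsub => ?_⟩
    have := hsub (Finset.mem_univ i)
    simp at this
  simpa using this

/-- Priority is a strict linear order, so exactly `b` rows are chosen. -/
lemma card_topRows {r : ℕ} (p : Fin r → ℕ) {b : ℕ} (hb : b ≤ r) : (topRows p b).card = b := by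
  let f : Fin r → Fin r := fun i => ⟨priorityRank p i, priorityRank_lt_card p i⟩
  have hinj : Function.Injective f := by
    intro i k hik
    have hik' : priorityRank p i = priorityRank p k := by simpa [f] using hik
    by_contra hne
    have h : (p i < p k ∨ (p k = p i ∧ i < k)) ∨ (p k < p i ∨ (p i = p k ∧ k < i)) := by
      omega
    rcases h with h | h
    · have := priorityRank_lt h; omega
    · have := priorityRank_lt h; omega
  have hbij : Function.Bijective f := hinj.bijective_of_finite
  have : (topRows p b).card = (Finset.univ.filter fun x : Fin r => (x : ℕ) < b).card := by
    apply Finset.card_bijective f hbij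
    intro i
    simp [mem_topRows, f]
  rw [this, Fin.card_filter_val_lt]
  omega

/-- The partition left after one box has been removed from each of the `b` largest parts. -/
def removeTop {r : ℕ} (p : Fin r → ℕ) (b : ℕ) : Fin r → ℕ :=
  fun i => if i ∈ topRows p b then p i - 1 else p i

/-- The reason for the southern tie-break. -/
lemma removeTop_antitone {r : ℕ} {p : Fin r → ℕ} (hp : Antitone p) (b : ℕ) :
    Antitone (removeTop p b) := by
  intro i k hik
  have h1 := hp hik
  rcases hik.eq_or_lt with rfl | hlt
  · exact le_rfl
  have h2 : p k = p i → i ∈ topRows p b → k ∈ topRows p b := fun he hi =>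
    mem_topRows_of_priority hi (Or.inr ⟨he, hlt⟩)
  simp only [removeTop]
  split_ifs with hk hi hi
  · omega
  · omega
  · have : p k ≠ p i := fun he => hk (h2 he hi)
    omega
  · exact h1

/-! ### The Gale–Ryser condition -/

/-- The Gale–Ryser condition for a matrix with row sums `p` and column sums `β 0, …, β (j - 1)`,
the domination being expressed by the numbers of boxes outside the first `k` columns. -/
def GaleRyser {r : ℕ} (β : ℕ → ℕ) (p : Fin r → ℕ) (j : ℕ) : Prop :=
  (∀ k ≤ j, ∑ i, (p i - k) ≤ ∑ c ∈ Finset.Ico k j, β c) ∧ ∑ i, p i = ∑ c ∈ Finset.Ico 0 j, β c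

lemma GaleRyser.le {r : ℕ} {β : ℕ → ℕ} {p : Fin r → ℕ} {j : ℕ} (h : GaleRyser β p j)
    (i : Fin r) : p i ≤ j := by
  have h1 := h.1 j le_rfl
  simp only [Finset.Ico_self, Finset.sum_empty, nonpos_iff_eq_zero, Finset.sum_eq_zero_iff,
    Finset.mem_univ, true_implies] at h1
  have := h1 i
  omega

/-- There are enough nonzero parts for a column of length `β j`. -/
lemma GaleRyser.pos_of_mem {r : ℕ} {β : ℕ → ℕ} {p : Fin r → ℕ} {j : ℕ} (hβ : Antitone β)
    (h : GaleRyser β p (j + 1)) {i : Fin r} (hi : i ∈ topRows p (β j)) : 0 < p i := by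
  by_contra h0
  have h1 := h.1 1 (by omega)
  have h2 := h.2
  rw [Finset.sum_eq_sum_Ico_succ_bot (by omega)] at h2
  have h3 : ∑ i, p i = ∑ i, (p i - 1) + (Finset.univ.filter fun k => 0 < p k).card := by
    rw [Finset.card_filter, ← Finset.sum_add_distrib]
    refine Finset.sum_congr rfl fun k _ => ?_
    split_ifs <;> omega
  have h4 : (Finset.univ.filter fun k => 0 < p k).card ≤ priorityRank p i := by
    apply Finset.card_le_card
    intro k hk
    simp only [Finset.mem_filter, Finset.mem_univ, true_and] at hk ⊢
    left; omega
  have h5 := mem_topRows.1 hi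
  have h6 := hβ (Nat.zero_le j)
  simp only [zero_add] at h2
  omega

/-- One step of Ryser's algorithm preserves the Gale–Ryser condition. -/
lemma GaleRyser.removeTop {r : ℕ} {β : ℕ → ℕ} {p : Fin r → ℕ} {j : ℕ} (hβ : Antitone β)
    (hr : β j ≤ r) (h : GaleRyser β p (j + 1)) : GaleRyser β (removeTop p (β j)) j := by
  have key : ∀ k ≤ j, (∀ i ∈ topRows p (β j), k < p i) →
      ∑ i, (KGR.removeTop p (β j) i - k) + β j = ∑ i, (p i - k) := by
    intro k _ hk
    have hcard := card_topRows p hr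
    rw [Finset.card_eq_sum_ones] at hcard
    rw [← Finset.sum_filter_add_sum_filter_not Finset.univ
      (fun i => i ∈ topRows p (β j)) (fun i => p i - k),
      ← Finset.sum_filter_add_sum_filter_not Finset.univ
      (fun i => i ∈ topRows p (β j)) (fun i => KGR.removeTop p (β j) i - k)]
    have e1 : Finset.univ.filter (fun i => i ∈ topRows p (β j)) = topRows p (β j) := by
      ext; simp
    rw [e1]
    have e2 : ∑ i ∈ topRows p (β j), (p i - k) =
        ∑ i ∈ topRows p (β j), (KGR.removeTop p (β j) i - k) + ∑ i ∈ topRows p (β j), 1 := by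
      rw [← Finset.sum_add_distrib]
      refine Finset.sum_congr rfl fun i hi => ?_
      have := hk i hi
      simp only [KGR.removeTop, hi, if_true]
      omega
    have e3 : ∑ i with i ∉ topRows p (β j), (p i - k) =
        ∑ i with i ∉ topRows p (β j), (KGR.removeTop p (β j) i - k) := by
      refine Finset.sum_congr rfl fun i hi => ?_
      simp only [Finset.mem_filter, Finset.mem_univ, true_and] at hi
      simp [KGR.removeTop, hi]
    omega
  refine ⟨fun k hk => ?_, ?_⟩
  · by_cases hc : ∀ i ∈ topRows p (β j), k < p i
    · have h1 := key k hk hc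
      have h2 := h.1 k (by omega)
      rw [Finset.sum_Ico_succ_top hk] at h2
      omega
    · -- Now every part larger than `k` is chosen, and losing a box amounts to a shift of `k`.
      push Not at hc
      obtain ⟨i₀, hi₀, hle⟩ := hc
      have h1 : ∑ i, (KGR.removeTop p (β j) i - k) = ∑ i, (p i - (k + 1)) := by
        refine Finset.sum_congr rfl fun i _ => ?_
        by_cases hi : k < p i
        · have : i ∈ topRows p (β j) := mem_topRows_of_priority hi₀ (Or.inl (by omega))
          simp only [KGR.removeTop, this, if_true]
          omega
        · simp only [KGR.removeTop]
          split_ifs <;> omega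
      rw [h1]
      refine (h.1 (k + 1) (by omega)).trans ?_
      rw [← Finset.sum_Ico_add' β k j 1]
      exact Finset.sum_le_sum fun c _ => hβ (Nat.le_succ c)
  · have h1 := key 0 (Nat.zero_le _) fun i hi => h.pos_of_mem hβ hi
    have h2 := h.2
    rw [Finset.sum_Ico_succ_top (Nat.zero_le j)] at h2
    simp only [Nat.sub_zero] at h1
    omega

lemma conjPart_antitone {r : ℕ} (lam : Fin r → ℕ) : Antitone (conjPart lam) := by
  intro j k hjk
  apply Finset.card_le_card
  intro i hi
  simp only [Finset.mem_filter, Finset.mem_univ, true_and] at hi ⊢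
  omega

lemma conjPart_le {r : ℕ} (lam : Fin r → ℕ) (j : ℕ) : conjPart lam j ≤ r := by
  unfold conjPart
  exact (Finset.card_filter_le _ _).trans (by simp)

lemma conjPart_pos {r : ℕ} {lam : Fin r → ℕ} {j : ℕ} (hj : j < firstPart lam) :
    0 < conjPart lam j := by
  unfold firstPart at hj
  split_ifs at hj with h
  · exact Finset.card_pos.2 ⟨⟨0, h⟩, by simpa using hj⟩
  · omega

lemma le_firstPart {r : ℕ} {lam : Fin r → ℕ} (hlam : Antitone lam) (i : Fin r) :
    lam i ≤ firstPart lam := by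
  have h : 0 < r := i.pos
  simp only [firstPart, h, dif_pos]
  exact hlam (by simp [Fin.le_def])

lemma sum_sub_eq_sum_conjPart {r : ℕ} {lam : Fin r → ℕ} {s : ℕ} (hs : ∀ i, lam i ≤ s) (k : ℕ) :
    ∑ i, (lam i - k) = ∑ c ∈ Finset.Ico k s, conjPart lam c := by
  simp only [conjPart, Finset.card_filter]
  rw [Finset.sum_comm]
  refine Finset.sum_congr rfl fun i _ => ?_
  rw [← Finset.card_filter]
  have : (Finset.Ico k s).filter (fun c => c < lam i) = Finset.Ico k (lam i) := by
    ext c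
    have := hs i
    simp only [Finset.mem_filter, Finset.mem_Ico]
    omega
  rw [this, Nat.card_Ico]

/-- Domination in terms of the numbers of boxes outside the first `k` columns. -/
lemma sum_sub_le_of_dominates {r : ℕ} {lam mu : Fin r → ℕ} (hmu : Antitone mu)
    (hdom : ∀ t : Fin r, ∑ i ∈ Finset.Iic t, mu i ≤ ∑ i ∈ Finset.Iic t, lam i) (k : ℕ) :
    ∑ i, (mu i - k) ≤ ∑ i, (lam i - k) := by
  by_cases hne : (Finset.univ.filter fun i => k < mu i).Nonempty
  · obtain ⟨t, ht, hmax⟩ := Finset.exists_max_image _ id hne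
    simp only [Finset.mem_filter, Finset.mem_univ, true_and, id] at ht hmax
    have h1 : ∑ i, (mu i - k) = ∑ i ∈ Finset.Iic t, (mu i - k) := by
      symm
      apply Finset.sum_subset (Finset.subset_univ _)
      intro i _ hi
      by_contra h0
      exact hi (Finset.mem_Iic.2 (hmax i (by omega)))
    have h2 : ∑ i ∈ Finset.Iic t, (mu i - k) + ∑ i ∈ Finset.Iic t, k =
        ∑ i ∈ Finset.Iic t, mu i := by
      rw [← Finset.sum_add_distrib]
      refine Finset.sum_congr rfl fun i hi => ?_
      have := hmu (Finset.mem_Iic.1 hi)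
      omega
    have h3 : ∑ i ∈ Finset.Iic t, lam i ≤
        ∑ i ∈ Finset.Iic t, (lam i - k) + ∑ i ∈ Finset.Iic t, k := by
      rw [← Finset.sum_add_distrib]
      exact Finset.sum_le_sum fun i _ => by omega
    have h4 : ∑ i ∈ Finset.Iic t, (lam i - k) ≤ ∑ i, (lam i - k) :=
      Finset.sum_le_sum_of_subset (Finset.subset_univ _)
    have := hdom t
    omega
  · have : ∑ i, (mu i - k) = 0 := by
      refine Finset.sum_eq_zero fun i _ => ?_
      by_contra h0
      exact hne ⟨i, by simp; omega⟩
    omega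

lemma IsKostkaPair.galeRyser {r : ℕ} {lam mu : Fin r → ℕ} (h : IsKostkaPair lam mu) :
    GaleRyser (conjPart lam) mu (firstPart lam) := by
  obtain ⟨hlam, hmu, hdom, hsum⟩ := h
  refine ⟨fun k _ => ?_, ?_⟩
  · rw [← sum_sub_eq_sum_conjPart (le_firstPart hlam)]
    exact sum_sub_le_of_dominates hmu hdom k
  · rw [← hsum, ← sum_sub_eq_sum_conjPart (le_firstPart hlam)]
    simp

/-! ### The columns of the canonical matrix -/

/-- The partition `mu` after `k` steps of Ryser's algorithm, the boxes moved to their final columns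
having been removed. -/
def residual {r : ℕ} (lam mu : Fin r → ℕ) : ℕ → Fin r → ℕ
  | 0 => mu
  | k + 1 => removeTop (residual lam mu k) (conjPart lam (firstPart lam - 1 - k))

lemma residual_antitone {r : ℕ} {lam mu : Fin r → ℕ} (hmu : Antitone mu) (k : ℕ) :
    Antitone (residual lam mu k) := by
  induction k with
  | zero => exact hmu
  | succ k ih => exact removeTop_antitone ih _

lemma residual_galeRyser {r : ℕ} {lam mu : Fin r → ℕ} (h : IsKostkaPair lam mu) {k : ℕ}
    (hk : k ≤ firstPart lam) :
    GaleRyser (conjPart lam) (residual lam mu k) (firstPart lam - k) := by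
  induction k with
  | zero => exact h.galeRyser
  | succ k ih =>
    have h1 := ih (by omega)
    have h2 : firstPart lam - k = (firstPart lam - 1 - k) + 1 := by omega
    have h3 : firstPart lam - (k + 1) = firstPart lam - 1 - k := by omega
    rw [h2] at h1
    rw [h3]
    exact h1.removeTop (conjPart_antitone lam) (conjPart_le _ _)

/-- A matrix that is flush-left in its first `j + 1` columns has the expected row sums there. -/
lemma leftSum_of_flushLeft {r s : ℕ} {A : Matrix (Fin r) (Fin s) ℕ} {p : Fin r → ℕ} {j : Fin s}
    {i : Fin r} (hp : p i ≤ j + 1) (hA : ∀ c ≤ j, A i c = if (c : ℕ) < p i then 1 else 0) :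
    leftSum A j i = p i := by
  unfold leftSum
  rw [Finset.sum_congr rfl fun c hc => hA c (Finset.mem_Iic.1 hc), ← Finset.card_filter]
  have h1 : (Finset.Iic j).filter (fun c : Fin s => (c : ℕ) < p i) =
      Finset.univ.filter fun c : Fin s => (c : ℕ) < p i := by
    ext c
    simp only [Finset.mem_filter, Finset.mem_Iic, Finset.mem_univ, true_and, Fin.le_def]
    omega
  rw [h1, Fin.card_filter_val_lt]
  have := j.2
  omega

/-- The matrix after `k` steps: the first columns are still flush-left, the others are final. -/
lemma ryserStage_apply {r : ℕ} {lam mu : Fin r → ℕ} (h : IsKostkaPair lam mu) {k : ℕ}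
    (hk : k ≤ firstPart lam) (i : Fin r) (c : Fin (firstPart lam)) :
    ryserStage lam mu k i c =
      if (c : ℕ) + k < firstPart lam then (if (c : ℕ) < residual lam mu k i then 1 else 0)
      else if i ∈ topRows (residual lam mu (firstPart lam - 1 - c)) (conjPart lam c) then 1
      else 0 := by
  induction k generalizing i c with
  | zero => rw [if_pos (by omega)]; rfl
  | succ k ih =>
    have hk' : k < firstPart lam := hk
    have ih := fun i c => ih (by omega) i c
    have hGR := residual_galeRyser h (k := k) (by omega)
    have hGR' := residual_galeRyser h (k := k + 1) hk
    obtain ⟨j, hj⟩ : ∃ j : Fin (firstPart lam), j = Fin.rev ⟨k, hk'⟩ := ⟨_, rfl⟩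
    have hjv : (j : ℕ) = firstPart lam - 1 - k := by
      simp only [hj, Fin.val_rev]; omega
    have hstep : ryserStage lam mu (k + 1) =
        shiftStep (ryserStage lam mu k) j (conjPart lam j) := by
      rw [ryserStage, dif_pos hk', hj]
    have hsum : ∀ i, leftSum (ryserStage lam mu k) j i = residual lam mu k i := by
      intro i
      apply leftSum_of_flushLeft
      · have := hGR.le i; omega
      · intro c hc
        rw [ih, if_pos]
        have : (c : ℕ) ≤ j := hc
        omega
    have hch : ∀ b, chosenRows (ryserStage lam mu k) j b = topRows (residual lam mu k) b := by
      intro b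
      have : leftSum (ryserStage lam mu k) j = residual lam mu k := funext hsum
      unfold chosenRows topRows priorityRank
      rw [this]
    have hpos : ∀ i ∈ topRows (residual lam mu k) (conjPart lam j), 0 < residual lam mu k i := by
      intro i hi
      have e : firstPart lam - k = (j : ℕ) + 1 := by omega
      rw [e] at hGR
      exact hGR.pos_of_mem (conjPart_antitone lam) hi
    have hres : residual lam mu (k + 1) i = if i ∈ topRows (residual lam mu k) (conjPart lam j)
        then residual lam mu k i - 1 else residual lam mu k i := by
      rw [hjv]; rfl
    have hle := hGR.le i
    have hle' := hGR'.le i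
    have hlast : c < j → (IsLastOne (ryserStage lam mu k) j i c ↔
        (c : ℕ) + 1 = residual lam mu k i) := by
      intro hcj
      have hcj' : (c : ℕ) < j := hcj
      unfold IsLastOne
      rw [ih, if_pos (by omega)]
      constructor
      · rintro ⟨-, h1, h2⟩
        have h3 : (c : ℕ) < residual lam mu k i := by by_contra h0; simp [h0] at h1
        by_contra h0
        refine h2 ⟨c + 1, by omega⟩ (Fin.lt_def.2 (by simp)) (Fin.le_def.2 (by simp; omega)) ?_
        rw [ih, if_pos (by simp; omega), if_pos (by simp; omega)]
      · intro h1
        refine ⟨hcj.le, by simp; omega, fun d hd hdj => ?_⟩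
        have hd' : (c : ℕ) < d := hd
        have hdj' : (d : ℕ) ≤ j := hdj
        rw [ih, if_pos (by omega), if_neg (by omega)]
        simp
    rw [hstep]
    unfold shiftStep
    rw [hch]
    rcases lt_trichotomy c j with hcj | hcj | hcj
    · have hcj' : (c : ℕ) < j := hcj
      rw [if_pos (show (c : ℕ) + (k + 1) < firstPart lam by omega), hres]
      by_cases hi : i ∈ topRows (residual lam mu k) (conjPart lam j)
      · have := hpos i hi
        rw [if_pos hi, if_neg hcj.ne, if_pos hi]
        by_cases hl : (c : ℕ) + 1 = residual lam mu k i
        · rw [if_pos ((hlast hcj).2 hl), if_neg (by omega)]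
        · rw [if_neg (fun h' => hl ((hlast hcj).1 h')), ih,
            if_pos (show (c : ℕ) + k < firstPart lam by omega)]
          congr 1
          simp only [eq_iff_iff]; omega
      · rw [if_neg hi, if_neg hi, ih, if_pos (by omega)]
    · subst hcj
      rw [if_neg (show ¬ (c : ℕ) + (k + 1) < firstPart lam by omega)]
      have e : firstPart lam - 1 - (c : ℕ) = k := by omega
      rw [e]
      by_cases hi : i ∈ topRows (residual lam mu k) (conjPart lam c)
      · rw [if_pos hi, if_pos rfl, if_pos hi]
      · rw [if_neg hi, if_neg hi, ih, if_pos (by omega), if_neg]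
        rw [hres, if_neg hi] at hle'
        omega
    · have hcj' : (j : ℕ) < c := hcj
      have hl : ¬ IsLastOne (ryserStage lam mu k) j i c := fun h' => absurd h'.1 (not_le.2 hcj)
      rw [if_neg hcj.ne', if_neg hl, ite_self, ih,
        if_neg (show ¬ (c : ℕ) + k < firstPart lam by omega),
        if_neg (show ¬ (c : ℕ) + (k + 1) < firstPart lam by omega)]

/-- The partition formed by the row sums of the first `j` columns of the canonical matrix. -/
def leftShape {r : ℕ} (lam mu : Fin r → ℕ) (j : ℕ) : Fin r → ℕ :=
  residual lam mu (firstPart lam - j)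

lemma leftShape_antitone {r : ℕ} {lam mu : Fin r → ℕ} (h : IsKostkaPair lam mu) (j : ℕ) :
    Antitone (leftShape lam mu j) := residual_antitone h.2.1 _

lemma canonicalMatrix_apply {r : ℕ} {lam mu : Fin r → ℕ} (h : IsKostkaPair lam mu)
    (i : Fin r) (c : Fin (firstPart lam)) :
    canonicalMatrix lam mu i c =
      if i ∈ topRows (leftShape lam mu (c + 1)) (conjPart lam c) then 1 else 0 := by
  unfold canonicalMatrix leftShape
  rw [ryserStage_apply h le_rfl, if_neg (by omega),
    show firstPart lam - 1 - (c : ℕ) = firstPart lam - ((c : ℕ) + 1) by omega]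

lemma leftShape_zero {r : ℕ} {lam mu : Fin r → ℕ} (h : IsKostkaPair lam mu) (i : Fin r) :
    leftShape lam mu 0 i = 0 := by
  have := (residual_galeRyser h (k := firstPart lam) le_rfl).le i
  simpa [leftShape] using this

lemma leftShape_pos {r : ℕ} {lam mu : Fin r → ℕ} (h : IsKostkaPair lam mu)
    (c : Fin (firstPart lam)) {i : Fin r}
    (hi : i ∈ topRows (leftShape lam mu (c + 1)) (conjPart lam c)) :
    0 < leftShape lam mu (c + 1) i := by
  have hGR := residual_galeRyser h (k := firstPart lam - (c + 1)) (by omega)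
  have hc := c.2
  rw [show firstPart lam - (firstPart lam - ((c : ℕ) + 1)) = (c : ℕ) + 1 by omega] at hGR
  exact hGR.pos_of_mem (conjPart_antitone lam) hi

lemma leftShape_succ {r : ℕ} {lam mu : Fin r → ℕ} (h : IsKostkaPair lam mu)
    (c : Fin (firstPart lam)) (i : Fin r) :
    leftShape lam mu (c + 1) i = leftShape lam mu c i + canonicalMatrix lam mu i c := by
  have hpos := leftShape_pos h c (i := i)
  have hc := c.2
  have e : leftShape lam mu c i = removeTop (leftShape lam mu (c + 1)) (conjPart lam c) i := by
    unfold leftShape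
    have e1 : firstPart lam - (c : ℕ) = (firstPart lam - (c + 1)) + 1 := by omega
    have e2 : firstPart lam - 1 - (firstPart lam - ((c : ℕ) + 1)) = c := by omega
    rw [e1, residual, e2]
  rw [e, canonicalMatrix_apply h, removeTop]
  split_ifs with hi
  · have := hpos hi; omega
  · rfl

lemma exists_canonicalMatrix_eq_one {r : ℕ} {lam mu : Fin r → ℕ} (h : IsKostkaPair lam mu)
    (c : Fin (firstPart lam)) : ∃ i, canonicalMatrix lam mu i c = 1 := by
  have h1 := card_topRows (leftShape lam mu (c + 1)) (conjPart_le lam c)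
  obtain ⟨i, hi⟩ := Finset.card_pos.1 (h1 ▸ conjPart_pos c.2)
  exact ⟨i, by rw [canonicalMatrix_apply h, if_pos hi]⟩

/-! ### The matrix of differences -/

/-- Row `n` of column `c` of the canonical matrix holds a `1`; rows beyond the last one count
as zero. -/
def IsFilled {r : ℕ} (lam mu : Fin r → ℕ) (c : Fin (firstPart lam)) (n : ℕ) : Prop :=
  ∃ h : n < r, ⟨n, h⟩ ∈ topRows (leftShape lam mu (c + 1)) (conjPart lam c)

/-- The difference of the parts `i` and `i + 1` of the partition formed by the row sums of the
first `j` columns of the canonical matrix, i.e. the sum of the first `j` entries of row `i`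
of `A*`. -/
def excess {r : ℕ} (lam mu : Fin r → ℕ) (j : ℕ) (i : Fin r) : ℤ :=
  (leftShape lam mu j i : ℤ) -
    (if h : (i : ℕ) + 1 < r then (leftShape lam mu j ⟨i + 1, h⟩ : ℤ) else 0)

section

variable {r : ℕ} {lam mu : Fin r → ℕ}

lemma excess_nonneg (h : IsKostkaPair lam mu) (j : ℕ) (i : Fin r) : 0 ≤ excess lam mu j i := by
  unfold excess
  split_ifs with hi
  · have := leftShape_antitone h j (show i ≤ ⟨i + 1, hi⟩ from Fin.le_def.2 (Nat.le_succ _))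
    omega
  · omega

lemma excess_zero (h : IsKostkaPair lam mu) (i : Fin r) : excess lam mu 0 i = 0 := by
  simp [excess, leftShape_zero h]

lemma excess_succ (h : IsKostkaPair lam mu) (c : Fin (firstPart lam)) (i : Fin r) :
    excess lam mu (c + 1) i = excess lam mu c i + canonicalStar lam mu i c := by
  simp only [excess, canonicalStar, starMatrix]
  split_ifs with hi
  · rw [leftShape_succ h, leftShape_succ h]; push_cast; ring
  · rw [leftShape_succ h]; push_cast; ring

lemma not_isFilled (c : Fin (firstPart lam)) : ¬ IsFilled lam mu c r :=
  fun ⟨h, _⟩ => absurd h (lt_irrefl r)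

open Classical in
lemma canonicalStar_eq (h : IsKostkaPair lam mu) (i : Fin r) (c : Fin (firstPart lam)) :
    canonicalStar lam mu i c =
      (if IsFilled lam mu c i then 1 else 0) - (if IsFilled lam mu c (i + 1) then 1 else 0) := by
  have h1 : IsFilled lam mu c i ↔
      i ∈ topRows (leftShape lam mu (c + 1)) (conjPart lam c) :=
    ⟨fun ⟨_, h⟩ => h, fun h => ⟨i.2, h⟩⟩
  simp only [canonicalStar, starMatrix, canonicalMatrix_apply h, h1]
  by_cases hi : (i : ℕ) + 1 < r
  · simp [IsFilled, hi]
  · simp [IsFilled, hi]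

lemma canonicalStar_eq_one (h : IsKostkaPair lam mu) {i : Fin r} {c : Fin (firstPart lam)} :
    canonicalStar lam mu i c = 1 ↔ IsFilled lam mu c i ∧ ¬ IsFilled lam mu c (i + 1) := by
  rw [canonicalStar_eq h]
  split_ifs <;> simp_all

lemma canonicalStar_eq_neg_one (h : IsKostkaPair lam mu) {i : Fin r} {c : Fin (firstPart lam)} :
    canonicalStar lam mu i c = -1 ↔ ¬ IsFilled lam mu c i ∧ IsFilled lam mu c (i + 1) := by
  rw [canonicalStar_eq h]
  split_ifs <;> simp_all

lemma canonicalStar_mem (h : IsKostkaPair lam mu) (i : Fin r) (c : Fin (firstPart lam)) :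
    canonicalStar lam mu i c = -1 ∨ canonicalStar lam mu i c = 0 ∨
      canonicalStar lam mu i c = 1 := by
  rw [canonicalStar_eq h]
  split_ifs <;> simp

/-- A property that holds at `k` and fails at `x` is lost at some step from `k` to `x`. -/
lemma exists_step_of_not {N : ℕ → Prop} {k x : ℕ} (hkx : k ≤ x) (hk : N k) (hx : ¬ N x) :
    ∃ y, k ≤ y ∧ y < x ∧ N y ∧ ¬ N (y + 1) := by
  induction x, hkx using Nat.le_induction with
  | base => exact absurd hk hx
  | succ x hkx ih =>
    by_cases hN : N x
    · exact ⟨x, hkx, Nat.lt_succ_self x, hN, hx⟩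
    · obtain ⟨y, h1, h2, h3⟩ := ih hN
      exact ⟨y, h1, h2.trans (Nat.lt_succ_self x), h3⟩

lemma exists_eq_one_of_isFilled (h : IsKostkaPair lam mu) {c : Fin (firstPart lam)} {k x : ℕ}
    (hx : x ≤ r) (hkx : k ≤ x) (h1 : IsFilled lam mu c k) (h2 : ¬ IsFilled lam mu c x) :
    ∃ y : Fin r, k ≤ y ∧ (y : ℕ) < x ∧ canonicalStar lam mu y c = 1 := by
  obtain ⟨y, h3, h4, h5⟩ := exists_step_of_not hkx h1 h2
  exact ⟨⟨y, by omega⟩, h3, h4, (canonicalStar_eq_one h).2 h5⟩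

/-- Every column of `A*` contains a `1`. -/
lemma exists_canonicalStar_eq_one (h : IsKostkaPair lam mu) (c : Fin (firstPart lam)) :
    ∃ y, canonicalStar lam mu y c = 1 := by
  obtain ⟨i, hi⟩ := exists_canonicalMatrix_eq_one h c
  rw [canonicalMatrix_apply h] at hi
  obtain ⟨y, -, -, hy⟩ := exists_eq_one_of_isFilled h (c := c) (k := i) le_rfl i.2.le
    ⟨i.2, by simpa using hi⟩ (not_isFilled c)
  exact ⟨y, hy⟩

/-- Every `-1` of `A*` has a `1` below it. -/
lemma exists_one_below (h : IsKostkaPair lam mu) {x : Fin r} {c : Fin (firstPart lam)}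
    (hx : canonicalStar lam mu x c = -1) : ∃ y, x < y ∧ canonicalStar lam mu y c = 1 := by
  have h1 := ((canonicalStar_eq_neg_one h).1 hx).2
  obtain ⟨y, h2, -, hy⟩ := exists_eq_one_of_isFilled h le_rfl x.2 h1 (not_isFilled c)
  exact ⟨y, Fin.lt_def.2 (by omega), hy⟩

/-- Two `1`s in a column of `A*` are separated by a `-1`. -/
lemma exists_neg_one_between (h : IsKostkaPair lam mu) {y z : Fin r} {c : Fin (firstPart lam)}
    (hyz : y < z) (hy : canonicalStar lam mu y c = 1) (hz : canonicalStar lam mu z c = 1) :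
    ∃ x, y < x ∧ x < z ∧ canonicalStar lam mu x c = -1 := by
  have h1 := ((canonicalStar_eq_one h).1 hy).2
  have h2 := ((canonicalStar_eq_one h).1 hz).1
  have hyz' : (y : ℕ) < z := hyz
  obtain ⟨x, h3, h4, h5, h6⟩ := exists_step_of_not (N := fun n => ¬ IsFilled lam mu c n)
    (Nat.succ_le_of_lt hyz') h1 (not_not.2 h2)
  have hz := z.2
  exact ⟨⟨x, by omega⟩, Fin.lt_def.2 (by simp; omega), Fin.lt_def.2 h4,
    (canonicalStar_eq_neg_one h).2 ⟨h5, not_not.1 h6⟩⟩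

/-- Where `A*` has a `-1`, the two rows of the partition are equal: otherwise the northern row
would have been chosen before the southern one. -/
lemma excess_eq_zero (h : IsKostkaPair lam mu) {x : Fin r} {c : Fin (firstPart lam)}
    (hx : canonicalStar lam mu x c = -1) : excess lam mu (c + 1) x = 0 := by
  obtain ⟨h1, h2, h3⟩ := (canonicalStar_eq_neg_one h).1 hx
  have h4 := excess_nonneg h (c + 1) x
  simp only [excess, h2, dif_pos] at h4 ⊢
  by_contra h0
  exact h1 ⟨x.2, mem_topRows_of_priority h3 (Or.inl (by simp only [Fin.eta]; omega))⟩

lemma excess_pos_of_eq_one (h : IsKostkaPair lam mu) {x : Fin r} {c : Fin (firstPart lam)}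
    (hx : canonicalStar lam mu x c = 1) : 0 < excess lam mu (c + 1) x := by
  have := excess_nonneg h c x
  rw [excess_succ h, hx]
  omega

lemma excess_eq_one_of_eq_neg_one (h : IsKostkaPair lam mu) {x : Fin r}
    {c : Fin (firstPart lam)} (hx : canonicalStar lam mu x c = -1) : excess lam mu c x = 1 := by
  have h1 := excess_eq_zero h hx
  rw [excess_succ h, hx] at h1
  omega

/-- Between a `-1` and a row of positive excess north of it there is a `1` of the same column,
possibly in that row itself: the rows down to there have larger parts than the row just below the
`-1`, which is chosen, so they are chosen as well. -/
lemma exists_one_above_of_excess_pos (h : IsKostkaPair lam mu) {x k : Fin r}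
    {c : Fin (firstPart lam)} (hx : canonicalStar lam mu x c = -1)
    (hk : 0 < excess lam mu (c + 1) k) (hkx : k < x) :
    ∃ y, k ≤ y ∧ y < x ∧ canonicalStar lam mu y c = 1 := by
  obtain ⟨h1, h2, h3⟩ := (canonicalStar_eq_neg_one h).1 hx
  have hkx' : (k : ℕ) < x := hkx
  have hk1 : (k : ℕ) + 1 < r := by omega
  simp only [excess, hk1, dif_pos] at hk
  have h4 := leftShape_antitone h (c + 1)
    (show (⟨k + 1, hk1⟩ : Fin r) ≤ ⟨x + 1, h2⟩ from Fin.le_def.2 (by simp; omega))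
  have h5 : IsFilled lam mu c k :=
    ⟨k.2, mem_topRows_of_priority h3 (Or.inl (by simp only [Fin.eta]; omega))⟩
  obtain ⟨y, h6, h7, h8⟩ := exists_eq_one_of_isFilled h x.2.le hkx'.le h5 h1
  exact ⟨y, h6, h7, h8⟩

/-- The mirror image of `exists_one_above_of_excess_pos`. -/
lemma exists_one_below_of_excess_pos (h : IsKostkaPair lam mu) {x k : Fin r}
    {c : Fin (firstPart lam)} (hx : canonicalStar lam mu x c = -1)
    (hk : 0 < excess lam mu (c + 1) k) (hxk : x < k) :
    ∃ y, x < y ∧ y ≤ k ∧ canonicalStar lam mu y c = 1 := by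
  obtain ⟨h1, h2, h3⟩ := (canonicalStar_eq_neg_one h).1 hx
  have hxk' : (x : ℕ) < k := hxk
  have h5 : ¬ IsFilled lam mu c (k + 1) := by
    rintro ⟨h4, h5⟩
    simp only [excess, h4, dif_pos] at hk
    have h6 := leftShape_antitone h (c + 1) hxk.le
    exact h1 ⟨x.2, mem_topRows_of_priority h5 (Or.inl (by simp only [Fin.eta]; omega))⟩
  obtain ⟨y, h6, h7, h8⟩ := exists_eq_one_of_isFilled h (k := x + 1) k.2 (by omega)
    ⟨h2, h3⟩ h5
  exact ⟨y, Fin.lt_def.2 (by omega), Fin.le_def.2 (by omega), h8⟩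

/-- A column of `A*` contains at most one `-1`. -/
lemma neg_one_unique (h : IsKostkaPair lam mu) {x y : Fin r} {c : Fin (firstPart lam)}
    (hx : canonicalStar lam mu x c = -1) (hy : canonicalStar lam mu y c = -1) : x = y := by
  by_contra hne
  wlog hlt : x < y generalizing x y
  · exact this hy hx (Ne.symm hne) (lt_of_le_of_ne (not_lt.1 hlt) (Ne.symm hne))
  have hlt' : (x : ℕ) < y := hlt
  obtain ⟨h1, h2, h3⟩ := (canonicalStar_eq_neg_one h).1 hx
  obtain ⟨h4, h5, h6⟩ := (canonicalStar_eq_neg_one h).1 hy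
  -- Between the two lies a row that is chosen while the next one is not, so the parts of the
  -- partition drop there, and row `x` has priority over row `y + 1`.
  obtain ⟨z, h7, h8, h9⟩ := exists_eq_one_of_isFilled h y.2.le (by omega) ⟨h2, h3⟩ h4
  have h10 := excess_pos_of_eq_one h h9
  have hz : (z : ℕ) + 1 < r := by omega
  simp only [excess, hz, dif_pos] at h10
  have h11 := leftShape_antitone h (c + 1) (show x ≤ z from Fin.le_def.2 (by omega))
  have h12 := leftShape_antitone h (c + 1)
    (show (⟨z + 1, hz⟩ : Fin r) ≤ ⟨y + 1, h5⟩ from Fin.le_def.2 (by simp; omega))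
  exact h1 ⟨x.2, mem_topRows_of_priority h6 (Or.inl (by simp only [Fin.eta]; omega))⟩

lemma excess_le_of_forall_ne_one (h : IsKostkaPair lam mu) {x : Fin r} {j k : ℕ} (hjk : j ≤ k)
    (hk : k ≤ firstPart lam)
    (h0 : ∀ c : Fin (firstPart lam), j ≤ c → c < k → canonicalStar lam mu x c ≠ 1) :
    excess lam mu k x ≤ excess lam mu j x := by
  induction k, hjk using Nat.le_induction with
  | base => rfl
  | succ k hjk ih =>
    have h1 := excess_succ h ⟨k, hk⟩ x
    have h2 := h0 ⟨k, hk⟩ hjk (Nat.lt_succ_self k)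
    have h3 := canonicalStar_mem h x ⟨k, hk⟩
    have h4 := ih (by omega) fun c hc hck => h0 c hc (by omega)
    simp only at h1
    omega

lemma le_excess_of_forall_ne_neg_one (h : IsKostkaPair lam mu) {x : Fin r} {j k : ℕ}
    (hjk : j ≤ k) (hk : k ≤ firstPart lam)
    (h0 : ∀ c : Fin (firstPart lam), j ≤ c → c < k → canonicalStar lam mu x c ≠ -1) :
    excess lam mu j x ≤ excess lam mu k x := by
  induction k, hjk using Nat.le_induction with
  | base => rfl
  | succ k hjk ih =>
    have h1 := excess_succ h ⟨k, hk⟩ x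
    have h2 := h0 ⟨k, hk⟩ hjk (Nat.lt_succ_self k)
    have h3 := canonicalStar_mem h x ⟨k, hk⟩
    have h4 := ih (by omega) fun c hc hck => h0 c hc (by omega)
    simp only at h1
    omega

/-! ### Arcs of the KGR graph -/

namespace Vertex

lemma ext_row_col {u v : Vertex lam mu} (hr : u.row = v.row) (hc : u.col = v.col) : u = v :=
  Subtype.ext (Prod.ext hr hc)

lemma entry_cases (h : IsKostkaPair lam mu) (u : Vertex lam mu) :
    u.entry = -1 ∨ u.entry = 1 := by
  have h1 := canonicalStar_mem h u.row u.col
  have h2 : canonicalStar lam mu u.row u.col ≠ 0 := u.2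
  unfold entry
  tauto

lemma exists_of_ne_zero {x : Fin r} {c : Fin (firstPart lam)}
    (hx : canonicalStar lam mu x c ≠ 0) : ∃ u : Vertex lam mu, u.row = x ∧ u.col = c ∧
      u.entry = canonicalStar lam mu x c :=
  ⟨⟨(x, c), hx⟩, rfl, rfl, rfl⟩

lemma exists_of_eq_one {x : Fin r} {c : Fin (firstPart lam)}
    (hx : canonicalStar lam mu x c = 1) : ∃ u : Vertex lam mu, u.row = x ∧ u.col = c ∧
      u.entry = 1 :=
  hx ▸ exists_of_ne_zero (by rw [hx]; decide)

lemma exists_of_eq_neg_one {x : Fin r} {c : Fin (firstPart lam)}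
    (hx : canonicalStar lam mu x c = -1) : ∃ u : Vertex lam mu, u.row = x ∧ u.col = c ∧
      u.entry = -1 :=
  hx ▸ exists_of_ne_zero (by rw [hx]; decide)

/-- A column contains at most one `-1`. -/
lemma eq_of_entry_eq_neg_one (h : IsKostkaPair lam mu) {u v : Vertex lam mu}
    (hu : u.entry = -1) (hv : v.entry = -1) (hc : u.col = v.col) : u = v := by
  refine ext_row_col (neg_one_unique h (c := u.col) hu ?_) hc
  rw [hc]; exact hv

end Vertex

lemma exists_horizontalArc (h : IsKostkaPair lam mu) {u : Vertex lam mu} (hu : u.entry = -1) :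
    ∃ v, IsHorizontalArc u v := by
  have h1 : (Finset.univ.filter fun c => c < u.col ∧ canonicalStar lam mu u.row c = 1).Nonempty := by
    by_contra hne
    have h2 := excess_le_of_forall_ne_one h (x := u.row) (Nat.zero_le u.col) u.col.2.le
      fun c _ hc h1 => hne ⟨c, by simpa using ⟨hc, h1⟩⟩
    rw [excess_zero h, excess_eq_one_of_eq_neg_one h hu] at h2
    omega
  obtain ⟨c, hc, hmax⟩ := Finset.exists_max_image _ id h1
  simp only [Finset.mem_filter, Finset.mem_univ, true_and, id] at hc hmax
  obtain ⟨v, hv1, hv2, hv3⟩ := Vertex.exists_of_eq_one hc.2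
  refine ⟨v, hu, hv3, hv1, hv2 ▸ hc.1, fun w hw1 hw2 hw3 => ?_⟩
  rw [hv2]
  refine hmax _ ⟨hw3, ?_⟩
  rw [← hw2]
  exact hw1

/-- Distinct `-1`s of a row have distinct partners, as the row sums up to a `-1` vanish. -/
lemma IsHorizontalArc.left_unique (h : IsKostkaPair lam mu) {u u' v : Vertex lam mu}
    (hu : IsHorizontalArc u v) (hu' : IsHorizontalArc u' v) : u = u' := by
  by_contra hne
  wlog hlt : u.col < u'.col generalizing u u'
  · rcases (not_lt.1 hlt).lt_or_eq with h1 | h1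
    · exact this hu' hu (Ne.symm hne) h1
    · exact hne (Vertex.ext_row_col (hu.2.2.1.symm.trans hu'.2.2.1) h1.symm)
  have hrow : u'.row = u.row := hu'.2.2.1.symm.trans hu.2.2.1
  have h1 := excess_eq_zero h hu.1
  have h2 := excess_eq_one_of_eq_neg_one h hu'.1
  rw [hrow] at h2
  have h3 := excess_le_of_forall_ne_one h (x := u.row) (Nat.succ_le_of_lt hlt) u'.col.2.le
    fun c hc hc' h4 => by
      obtain ⟨w, hw1, hw2, hw3⟩ := Vertex.exists_of_eq_one h4
      have h5 := hu'.2.2.2.2 w hw3 (hw1.trans hrow.symm) (hw2 ▸ Fin.lt_def.2 hc')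
      have h6 := hu.2.2.2.1
      rw [hw2, Fin.le_def] at h5
      rw [Fin.lt_def] at h6
      omega
  rw [Nat.succ_eq_add_one] at h3
  omega

lemma adj_right_unique (h : IsKostkaPair lam mu) {u v v' : Vertex lam mu}
    (hv : (kgrGraph lam mu).Adj u v) (hv' : (kgrGraph lam mu).Adj u v') : v = v' := by
  rcases hv with hv | hv <;> rcases hv' with hv' | hv'
  · refine Vertex.ext_row_col (hv.2.2.1.trans hv'.2.2.1.symm) (le_antisymm ?_ ?_)
    · exact hv'.2.2.2.2 v hv.2.1 hv.2.2.1 hv.2.2.2.1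
    · exact hv.2.2.2.2 v' hv'.2.1 hv'.2.2.1 hv'.2.2.2.1
  · exact absurd (hv.1.symm.trans hv'.1) (by decide)
  · exact absurd (hv.1.symm.trans hv'.1) (by decide)
  · exact Vertex.eq_of_entry_eq_neg_one h hv.2.1 hv'.2.1 (hv.2.2.trans hv'.2.2.symm)

lemma isHorizontalArc_of_adj {u v : Vertex lam mu} (hu : u.entry = -1)
    (huv : (kgrGraph lam mu).Adj u v) : IsHorizontalArc u v :=
  huv.resolve_right fun h => absurd (hu.symm.trans h.1) (by decide)

lemma isVerticalArc_of_adj {u v : Vertex lam mu} (hu : u.entry = 1)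
    (huv : (kgrGraph lam mu).Adj u v) : IsVerticalArc u v :=
  huv.resolve_left fun h => absurd (hu.symm.trans h.1) (by decide)

/-- Only horizontal arcs end at a `1`. -/
lemma isHorizontalArc_of_adj_right {u v : Vertex lam mu} (hv : v.entry = 1)
    (huv : (kgrGraph lam mu).Adj u v) : IsHorizontalArc u v :=
  huv.resolve_right fun h => absurd (hv.symm.trans h.2.1) (by decide)

lemma isVerticalArc_of_adj_right {u v : Vertex lam mu} (hv : v.entry = -1)
    (huv : (kgrGraph lam mu).Adj u v) : IsVerticalArc u v :=
  huv.resolve_left fun h => absurd (hv.symm.trans h.2.1) (by decide)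

lemma exists_adj_of_entry_eq_neg_one (h : IsKostkaPair lam mu) {v : Vertex lam mu}
    (hv : v.entry = -1) : ∃ u, IsVerticalArc u v := by
  obtain ⟨y, -, hy⟩ := exists_one_below h hv
  obtain ⟨u, -, hu2, hu3⟩ := Vertex.exists_of_eq_one hy
  exact ⟨u, hu3, hv, hu2.symm⟩

/-- The vertices of a column are connected through its `-1`, and a column without `-1` has a single
vertex. -/
lemma reachable_of_col_eq (h : IsKostkaPair lam mu) {u v : Vertex lam mu} (hc : u.col = v.col) :
    (kgrGraph lam mu).toSimpleGraphInclusive.Reachable u v := by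
  have hadj : ∀ a b : Vertex lam mu, IsVerticalArc a b →
      (kgrGraph lam mu).toSimpleGraphInclusive.Reachable a b := fun a b hab => by
    refine SimpleGraph.Adj.reachable ?_
    refine (SimpleGraph.fromRel_adj _ _ _).2 ⟨?_, Or.inl (Or.inr hab)⟩
    rintro rfl
    exact absurd (hab.1.symm.trans hab.2.1) (by decide)
  by_cases hw : ∃ w : Vertex lam mu, w.entry = -1 ∧ w.col = u.col
  · obtain ⟨w, hw1, hw2⟩ := hw
    have key : ∀ a : Vertex lam mu, a.col = u.col →
        (kgrGraph lam mu).toSimpleGraphInclusive.Reachable a w := by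
      intro a ha
      rcases a.entry_cases h with ha1 | ha1
      · rw [Vertex.eq_of_entry_eq_neg_one h ha1 hw1 (ha.trans hw2.symm)]
      · exact hadj a w ⟨ha1, hw1, hw2.trans ha.symm⟩
    exact (key u rfl).trans (key v hc.symm).symm
  · have hno : ∀ x : Fin r, canonicalStar lam mu x u.col ≠ -1 := fun x hx => by
      obtain ⟨w, -, hw2, hw3⟩ := Vertex.exists_of_eq_neg_one hx
      exact hw ⟨w, hw3, hw2⟩
    have hu := (u.entry_cases h).resolve_left (hno _)
    have hv := (v.entry_cases h).resolve_left fun hv => hw ⟨v, hv, hc.symm⟩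
    have hv' : canonicalStar lam mu v.row u.col = 1 := by rw [hc]; exact hv
    rcases lt_trichotomy u.row v.row with h1 | h1 | h1
    · obtain ⟨x, -, -, hx⟩ := exists_neg_one_between h h1 hu hv'
      exact absurd hx (hno x)
    · rw [Vertex.ext_row_col h1 hc]
    · obtain ⟨x, -, -, hx⟩ := exists_neg_one_between h h1 hv' hu
      exact absurd hx (hno x)

lemma adj_reachable {u v : Vertex lam mu} (huv : (kgrGraph lam mu).Adj u v) :
    (kgrGraph lam mu).toSimpleGraphInclusive.Reachable u v := by
  by_cases hne : u = v
  · rw [hne]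
  · exact SimpleGraph.Adj.reachable
      ((SimpleGraph.fromRel_adj _ _ _).2 ⟨hne, Or.inl huv⟩)

/-! ### Sums of columns of a matrix of differences -/

lemma antitone_sum_of_starMatrix {s : ℕ} {A : Matrix (Fin r) (Fin s) ℕ} {S : Finset (Fin s)}
    (hS : ∀ x, 0 ≤ ∑ c ∈ S, starMatrix A x c) : Antitone fun i => ∑ j ∈ S, A i j := by
  let f : ℕ → ℕ := fun n => if hn : n < r then ∑ j ∈ S, A ⟨n, hn⟩ j else 0
  have hf : Antitone f := by
    refine antitone_nat_of_succ_le fun n => ?_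
    by_cases hn : n + 1 < r
    · have h1 := hS ⟨n, by omega⟩
      simp only [starMatrix, hn, dif_pos, Finset.sum_sub_distrib, sub_nonneg] at h1
      have hn' : n < r := by omega
      simp only [f, hn, hn', dif_pos]
      exact_mod_cast h1
    · simp [f, hn]
  intro i k hik
  have := hf (Fin.le_def.1 hik)
  simpa [f] using this

lemma sum_starMatrix_nonneg {s : ℕ} {A : Matrix (Fin r) (Fin s) ℕ} {S : Finset (Fin s)}
    (hS : Antitone fun i => ∑ j ∈ S, A i j) (x : Fin r) : 0 ≤ ∑ c ∈ S, starMatrix A x c := by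
  by_cases hx : (x : ℕ) + 1 < r
  · have h1 := hS (show x ≤ ⟨x + 1, hx⟩ from Fin.le_def.2 (Nat.le_succ _))
    simp only [starMatrix, hx, dif_pos, Finset.sum_sub_distrib, sub_nonneg]
    exact_mod_cast h1
  · simp only [starMatrix, hx, dif_neg, not_false_eq_true, sub_zero]
    exact Finset.sum_nonneg fun c _ => Int.natCast_nonneg _

/-- If the `-1`s of a row in the columns of `S` can be matched injectively with `1`s in these
columns, then the sum of the row over `S` is nonnegative. -/
lemma sum_canonicalStar_nonneg (h : IsKostkaPair lam mu) {S : Finset (Fin (firstPart lam))}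
    (f : Vertex lam mu → Vertex lam mu)
    (hf : ∀ u : Vertex lam mu, u.entry = -1 → u.col ∈ S →
      (f u).entry = 1 ∧ (f u).row = u.row ∧ (f u).col ∈ S)
    (hinj : ∀ u v : Vertex lam mu, u.entry = -1 → u.col ∈ S → v.entry = -1 → v.col ∈ S →
      f u = f v → u = v) (x : Fin r) : 0 ≤ ∑ c ∈ S, canonicalStar lam mu x c := by
  let g : Fin (firstPart lam) → Fin (firstPart lam) := fun c =>
    if hc : canonicalStar lam mu x c ≠ 0 then (f ⟨(x, c), hc⟩).col else c
  have hg : ∀ u : Vertex lam mu, u.row = x → g u.col = (f u).col := by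
    rintro ⟨⟨x', c⟩, hc⟩ rfl
    exact dif_pos hc
  have hmem : ∀ c ∈ S.filter (fun c => canonicalStar lam mu x c = -1),
      ∃ u : Vertex lam mu, u.row = x ∧ u.col = c ∧ u.entry = -1 ∧ u.col ∈ S := by
    intro c hc
    obtain ⟨hc1, hc2⟩ := Finset.mem_filter.1 hc
    obtain ⟨u, hu1, hu2, hu3⟩ := Vertex.exists_of_eq_neg_one hc2
    exact ⟨u, hu1, hu2, hu3, hu2 ▸ hc1⟩
  have hcard : (S.filter fun c => canonicalStar lam mu x c = -1).card ≤
      (S.filter fun c => canonicalStar lam mu x c = 1).card := by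
    refine Finset.card_le_card_of_injOn g ?_ ?_
    · intro c hc
      obtain ⟨u, hu1, rfl, hu3, hu4⟩ := hmem c hc
      obtain ⟨h1, h2, h3⟩ := hf u hu3 hu4
      simp only [Finset.coe_filter, Set.mem_ofPred_eq]
      rw [hg u hu1]
      refine ⟨h3, ?_⟩
      rw [← hu1, ← h2]
      exact h1
    · intro c hc d hd hcd
      obtain ⟨u, hu1, rfl, hu3, hu4⟩ := hmem c hc
      obtain ⟨v, hv1, rfl, hv3, hv4⟩ := hmem d hd
      rw [hg u hu1, hg v hv1] at hcd
      have h1 := (hf u hu3 hu4).2.1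
      have h2 := (hf v hv3 hv4).2.1
      rw [hinj u v hu3 hu4 hv3 hv4
        (Vertex.ext_row_col (by rw [h1, h2, hu1, hv1]) hcd)]
  have hsum : ∑ c ∈ S, canonicalStar lam mu x c =
      ((S.filter fun c => canonicalStar lam mu x c = 1).card : ℤ) -
        (S.filter fun c => canonicalStar lam mu x c = -1).card := by
    rw [Finset.card_filter, Finset.card_filter]
    push_cast
    rw [← Finset.sum_sub_distrib]
    refine Finset.sum_congr rfl fun c _ => ?_
    rcases canonicalStar_mem h x c with h1 | h1 | h1 <;> simp [h1]
  omega

/-! ### A conservative subtree yields a decomposition -/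

open Classical in
/-- The columns that contain a vertex of a subgraph. -/
noncomputable def columnsOf (H : DiSubgraph (kgrGraph lam mu)) : Finset (Fin (firstPart lam)) :=
  Finset.univ.filter fun c => ∃ u ∈ H.verts, u.col = c

/-- A subgraph whose vertices fill its columns yields a decomposition if the `-1`s inside as well
as those outside the subgraph can be matched with `1`s. -/
lemma isReducible_of_matching (h : IsKostkaPair lam mu) {H : DiSubgraph (kgrGraph lam mu)}
    (hcol : ∀ u ∈ H.verts, ∀ v : Vertex lam mu, v.col = u.col → v ∈ H.verts)
    (hne : H.verts.Nonempty) (hproper : H.verts ≠ Set.univ)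
    (f : Vertex lam mu → Vertex lam mu)
    (hf : ∀ u : Vertex lam mu, u.entry = -1 →
      (f u).entry = 1 ∧ (f u).row = u.row ∧ ((f u) ∈ H.verts ↔ u ∈ H.verts))
    (hinj : ∀ u v : Vertex lam mu, u.entry = -1 → v.entry = -1 → f u = f v → u = v) :
    IsReducible (canonicalMatrix lam mu) := by
  have hmem : ∀ u : Vertex lam mu, u.col ∈ columnsOf H ↔ u ∈ H.verts := by
    intro u
    simp only [columnsOf, Finset.mem_filter, Finset.mem_univ, true_and]
    exact ⟨fun ⟨v, hv, hvc⟩ => hcol v hv u hvc.symm, fun hu => ⟨u, hu, rfl⟩⟩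
  refine ⟨columnsOf H, ?_, ?_, ?_, ?_⟩
  · obtain ⟨u, hu⟩ := hne
    exact ⟨u.col, (hmem u).2 hu⟩
  · intro huniv
    refine hproper (Set.eq_univ_of_forall fun u => (hmem u).1 ?_)
    rw [huniv]
    exact Finset.mem_univ _
  · refine antitone_sum_of_starMatrix (sum_canonicalStar_nonneg h f ?_ ?_)
    · intro u hu huS
      obtain ⟨h1, h2, h3⟩ := hf u hu
      exact ⟨h1, h2, (hmem _).2 (h3.2 ((hmem _).1 huS))⟩
    · exact fun u v hu _ hv _ => hinj u v hu hv
  · refine antitone_sum_of_starMatrix (sum_canonicalStar_nonneg h f ?_ ?_)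
    · intro u hu huS
      obtain ⟨h1, h2, h3⟩ := hf u hu
      rw [Finset.mem_compl, hmem] at huS ⊢
      exact ⟨h1, h2, fun h4 => huS (h3.1 h4)⟩
    · exact fun u v hu _ hv _ => hinj u v hu hv

lemma DiSubgraph.IsConnected.nonempty_verts {V : Type*} {G : Digraph V} {H : DiSubgraph G}
    (hH : H.IsConnected) : H.verts.Nonempty := by
  obtain ⟨u⟩ := hH.nonempty
  exact ⟨u.1, u.2⟩

lemma isReducible_of_isComponent (h : IsKostkaPair lam mu) {H : DiSubgraph (kgrGraph lam mu)}
    (hconn : H.IsConnected) (hproper : H.IsProper) (hcomp : H.IsComponent) :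
    IsReducible (canonicalMatrix lam mu) := by
  obtain ⟨C, hC, harcs⟩ := hcomp
  have hreach : ∀ u v : Vertex lam mu, (kgrGraph lam mu).toSimpleGraphInclusive.Reachable u v →
      (v ∈ H.verts ↔ u ∈ H.verts) := by
    intro u v huv
    rw [hC, SimpleGraph.ConnectedComponent.mem_supp_iff,
      SimpleGraph.ConnectedComponent.mem_supp_iff, SimpleGraph.ConnectedComponent.sound huv]
  choose! f hf using fun (u : Vertex lam mu) (hu : u.entry = -1) => exists_horizontalArc h hu
  refine isReducible_of_matching h
    (fun u hu v hv => (hreach u v (reachable_of_col_eq h hv.symm)).2 hu) hconn.nonempty_verts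
    (fun huniv => hproper ⟨huniv, fun u v huv => harcs u (huniv ▸ Set.mem_univ u) v
      (huniv ▸ Set.mem_univ v) huv⟩) f (fun u hu => ?_) fun u v hu hv huv => ?_
  · exact ⟨(hf u hu).2.1, (hf u hu).2.2.1, hreach _ _ (adj_reachable (Or.inl (hf u hu)))⟩
  · exact (hf u hu).left_unique h (huv ▸ hf v hv)

/-- The `-1` whose partner is the exceptional source is matched with the partner of the sink, and
the sink with the exceptional source; all the other `-1`s are matched along horizontal arcs. -/
lemma isReducible_of_sinkSourceCondition (h : IsKostkaPair lam mu)
    {H : DiSubgraph (kgrGraph lam mu)} (hvert : VerticallyClosed H)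
    (hH : SinkSourceCondition H) : IsReducible (canonicalMatrix lam mu) := by
  obtain ⟨⟨t, ht⟩, htsink, htuniq, htneg, ⟨s, hs⟩, hssrc, hspos, hrow, hsrc⟩ := hH
  dsimp only at htneg hspos hrow
  have hout : ∀ u ∈ H.verts, u ≠ t → ∃ v, H.Adj u v := by
    intro u hu hut
    by_contra! hno
    exact hut (congrArg Subtype.val (htuniq ⟨u, hu⟩ fun y => hno y))
  have hin : ∀ v ∈ H.verts, v ≠ s → ∀ u, (kgrGraph lam mu).Adj u v → ∃ u, H.Adj u v := by
    intro v hv hvs u huv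
    by_contra! hno
    exact hsrc ⟨v, hv⟩ (fun y => hno y) (fun he => hvs (congrArg Subtype.val he)) u huv
  -- Every vertex of the subgraph lies on one of its vertical arcs.
  have hneg : ∀ u ∈ H.verts, ∃ a b, H.Adj a b ∧ IsVerticalArc a b ∧ b.col = u.col := by
    intro u hu
    rcases u.entry_cases h with hu1 | hu1
    · obtain ⟨a, ha⟩ := exists_adj_of_entry_eq_neg_one h hu1
      obtain ⟨b, hb⟩ := hin u hu (fun he => by rw [he, hspos] at hu1; omega) a (Or.inr ha)
      exact ⟨b, u, hb, isVerticalArc_of_adj_right hu1 (H.adj_sub hb), rfl⟩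
    · obtain ⟨v, hv⟩ := hout u hu (fun he => by rw [he, htneg] at hu1; omega)
      have hv' := isVerticalArc_of_adj hu1 (H.adj_sub hv)
      exact ⟨u, v, hv, hv', hv'.2.2⟩
  have hcol : ∀ u ∈ H.verts, ∀ v : Vertex lam mu, v.col = u.col → v ∈ H.verts := by
    intro u hu v hv
    obtain ⟨a, b, hab, hab', hb⟩ := hneg u hu
    rcases v.entry_cases h with hv1 | hv1
    · rw [Vertex.eq_of_entry_eq_neg_one h hv1 hab'.2.1 (hv.trans hb.symm)]
      exact H.right_mem hab
    · refine H.left_mem (hvert a b v b hab hab' ⟨hv1, hab'.2.1, ?_⟩ ?_)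
      · rw [hb, hv]
      · rw [hv, ← hb, hab'.2.2]
  -- The column of the sink is the leftmost one: from any other `-1` there is an arc to the left.
  have hleft : ∀ u ∈ H.verts, t.col ≤ u.col := by
    intro u hu
    obtain ⟨m, hm, hmin⟩ := Set.exists_min_image H.verts Vertex.col (Set.toFinite _) ⟨u, hu⟩
    obtain ⟨a, b, hab, hab', hb⟩ := hneg m hm
    by_cases hbt : b = t
    · rw [← hbt, hb]; exact hmin u hu
    · obtain ⟨v, hv⟩ := hout b (H.right_mem hab) hbt
      have h1 := (isHorizontalArc_of_adj hab'.2.1 (H.adj_sub hv)).2.2.2.1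
      have h2 := hmin v (H.right_mem hv)
      rw [hb] at h1
      exact absurd h2 (not_le.2 h1)
  choose! m hm using fun (u : Vertex lam mu) (hu : u.entry = -1) => exists_horizontalArc h hu
  have hminj : ∀ u v, u.entry = -1 → v.entry = -1 → m u = m v → u = v := fun u v hu hv huv =>
    (hm u hu).left_unique h (huv ▸ hm v hv)
  have hmt : m t ∉ H.verts := fun hmem =>
    absurd (hleft _ hmem) (not_le.2 (hm t htneg).2.2.2.1)
  have hmts : m t ≠ s := fun he => hmt (he ▸ hs)
  classical
  have hmu : ∀ u, u.entry = -1 → u ≠ t → m u ≠ s → (m u ∈ H.verts ↔ u ∈ H.verts) := by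
    intro u hu hut hus
    constructor
    · intro hmem
      obtain ⟨u', hu'⟩ := hin _ hmem hus u (Or.inl (hm u hu))
      rw [(hm u hu).left_unique h (isHorizontalArc_of_adj_right (hm u hu).2.1 (H.adj_sub hu'))]
      exact H.left_mem hu'
    · intro hmem
      obtain ⟨v, hv⟩ := hout u hmem hut
      rw [adj_right_unique h (Or.inl (hm u hu)) (H.adj_sub hv)]
      exact H.right_mem hv
  have hms : ∀ u, u.entry = -1 → m u = s → u ∉ H.verts := by
    intro u hu hus hmem
    obtain ⟨v, hv⟩ := hout u hmem fun he => hmts (he ▸ hus)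
    rw [← adj_right_unique h (Or.inl (hm u hu)) (H.adj_sub hv), hus] at hv
    exact hssrc ⟨u, hmem⟩ hv
  refine isReducible_of_matching h hcol ⟨t, ht⟩
    (fun huniv => hmt (huniv ▸ Set.mem_univ _))
    (fun u => if u = t then s else if m u = s then m t else m u) (fun u hu => ?_)
    fun u v hu hv huv => ?_
  · split_ifs with h1 h2
    · subst h1; exact ⟨hspos, hrow, by simp [hs, ht]⟩
    · refine ⟨(hm t htneg).2.1, ?_, by simp [hmt, hms u hu h2]⟩
      rw [(hm t htneg).2.2.1, ← hrow, ← h2, (hm u hu).2.2.1]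
    · exact ⟨(hm u hu).2.1, (hm u hu).2.2.1, hmu u hu h1 h2⟩
  · have h1 := hminj u v hu hv
    have h2 := hminj t v htneg hv
    have h3 := hminj u t hu htneg
    split_ifs at huv <;> grind

open Relation

/-! ### Following a path through the graph -/

/-- Row `k` lies strictly between the rows `x` and `y`. -/
def StrictlyBetween (x y k : Fin r) : Prop := (x < k ∧ k < y) ∨ (y < k ∧ k < x)

/-- Strictly between a `-1` and a `1` of the same column, all excesses vanish, both before and after
the column has been removed. -/
lemma excess_eq_zero_of_strictlyBetween (h : IsKostkaPair lam mu) {c : Fin (firstPart lam)}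
    {y R k : Fin r} (hy : canonicalStar lam mu y c = -1) (hR : canonicalStar lam mu R c = 1)
    (hk : StrictlyBetween y R k) : excess lam mu (c + 1) k = 0 ∧ excess lam mu c k = 0 := by
  have hone : ∀ z, StrictlyBetween y R z → canonicalStar lam mu z c ≠ 1 := by
    rintro z (⟨h1, h2⟩ | ⟨h1, h2⟩) hz
    · obtain ⟨w, h3, -, hw⟩ := exists_neg_one_between h h2 hz hR
      have := neg_one_unique h hy hw
      omega
    · obtain ⟨w, -, h3, hw⟩ := exists_neg_one_between h h1 hR hz
      have := neg_one_unique h hy hw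
      omega
  have hzero : excess lam mu (c + 1) k = 0 := by
    by_contra h0
    have hpos := lt_of_le_of_ne (excess_nonneg h (c + 1) k) (Ne.symm h0)
    rcases hk with ⟨h1, h2⟩ | ⟨h1, h2⟩
    · obtain ⟨z, h3, h4, hz⟩ := exists_one_below_of_excess_pos h hy hpos h1
      exact hone z (Or.inl ⟨h3, h4.trans_lt h2⟩) hz
    · obtain ⟨z, h3, h4, hz⟩ := exists_one_above_of_excess_pos h hy hpos h2
      exact hone z (Or.inr ⟨h1.trans_le h3, h4⟩) hz
  refine ⟨hzero, ?_⟩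
  have h1 := excess_succ h c k
  rcases canonicalStar_mem h k c with h2 | h2 | h2
  · have := neg_one_unique h hy h2
    subst this
    rcases hk with ⟨h1, -⟩ | ⟨-, h1⟩ <;> exact absurd h1 (lt_irrefl _)
  · omega
  · exact absurd h2 (hone k hk)

/-- The nearest row of positive excess on either side of a `-1` holds a `1` of the same column. -/
lemma eq_one_of_excess_pos (h : IsKostkaPair lam mu) {c : Fin (firstPart lam)}
    {y R : Fin r} (hy : canonicalStar lam mu y c = -1) (hR : 0 < excess lam mu (c + 1) R)
    (hk : ∀ k, StrictlyBetween R y k → excess lam mu (c + 1) k = 0) :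
    canonicalStar lam mu R c = 1 := by
  rcases lt_trichotomy R y with h1 | h1 | h1
  · obtain ⟨z, h3, h4, hz⟩ := exists_one_above_of_excess_pos h hy hR h1
    rcases h3.eq_or_lt with rfl | h3
    · exact hz
    · have := excess_pos_of_eq_one h hz
      rw [hk z (Or.inl ⟨h3, h4⟩)] at this
      omega
  · rw [h1, excess_eq_zero h hy] at hR
    omega
  · obtain ⟨z, h3, h4, hz⟩ := exists_one_below_of_excess_pos h hy hR h1
    rcases h4.eq_or_lt with rfl | h4
    · exact hz
    · have := excess_pos_of_eq_one h hz
      rw [hk z (Or.inr ⟨h3, h4⟩)] at this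
      omega

/-- The `-1` at `v` lies in column `j` or to the right of it, its partner lies to the left of
column `j`, and among the rows of positive excess on its side of row `x`, when only the first `j`
columns are left, the row of `v` is the closest to `x`. -/
structure IsNearest (x : Fin r) (j : ℕ) (v : Vertex lam mu) : Prop where
  entry_eq : v.entry = -1
  le_col : j ≤ v.col
  excess_eq : excess lam mu j v.row = 1
  eq_zero : ∀ c : Fin (firstPart lam), j ≤ c → c < v.col → canonicalStar lam mu v.row c = 0
  row_ne : v.row ≠ x
  between : ∀ k, StrictlyBetween v.row x k → excess lam mu j k = 0

/-- If the partner of `v` lies in the last remaining column, there is an arc to it. -/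
lemma IsNearest.isHorizontalArc {x : Fin r} {c : Fin (firstPart lam)} {v u : Vertex lam mu}
    (hv : IsNearest x (c + 1) v) (hu : u.entry = 1) (hrow : u.row = v.row) (hcol : u.col = c) :
    IsHorizontalArc v u := by
  have h1 := hv.le_col
  refine ⟨hv.entry_eq, hu, hrow, by rw [hcol]; exact Fin.lt_def.2 h1, fun w hw1 hw2 hw3 => ?_⟩
  rw [hcol]
  by_contra h2
  have h3 := hv.eq_zero w.col (Nat.succ_le_of_lt (Fin.lt_def.1 (not_le.1 h2))) hw3
  rw [← hw2] at h3
  exact w.2 h3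

/-- If all entries of the row of `w` between the columns of `t` and `w` vanish, and if every column
to the right of `t` has a `-1`, then the path from the `1` at `w` stays next to the row of `w` up to
the column of `t`. -/
lemma exists_isNearest (h : IsKostkaPair lam mu) {w t : Vertex lam mu} (hw : w.entry = 1)
    (hneg : ∀ c, t.col < c → ∃ y, canonicalStar lam mu y c = -1)
    (hzero : ∀ c, t.col < c → c < w.col → canonicalStar lam mu w.row c = 0) {j : ℕ}
    (htj : t.col < j) (hjw : j ≤ w.col) :
    ∃ v, ReflTransGen (kgrGraph lam mu).Adj w v ∧ IsNearest w.row j v := by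
  induction hjw using Nat.decreasingInduction with
  | self =>
    obtain ⟨y, hy⟩ := hneg w.col (Fin.lt_def.2 htj)
    obtain ⟨v, rfl, hv2, hv3⟩ := Vertex.exists_of_eq_neg_one hy
    refine ⟨v, .single (Or.inr ⟨hw, hv3, hv2⟩), hv3, hv2 ▸ le_rfl,
      excess_eq_one_of_eq_neg_one h hy, fun c h1 h2 => ?_, fun he => ?_, fun k hk => ?_⟩
    · rw [hv2, Fin.lt_def] at h2; omega
    · rw [he] at hy
      exact absurd (hy.symm.trans hw) (by decide)
    · exact (excess_eq_zero_of_strictlyBetween h hy hw hk).2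
  | of_succ j hjw ih =>
    obtain ⟨v, hwv, hv⟩ := ih (by omega)
    obtain ⟨c, rfl⟩ : ∃ c : Fin (firstPart lam), (c : ℕ) = j :=
      ⟨⟨j, hjw.trans w.col.2⟩, rfl⟩
    obtain ⟨y, hy⟩ := hneg c htj
    have hyw : y ≠ w.row := by
      rintro rfl
      rw [hzero c htj hjw] at hy
      exact absurd hy (by decide)
    have hvpos : 0 < excess lam mu (c + 1) v.row := by rw [hv.excess_eq]; decide
    have hsame : ∀ k, k ≠ y → excess lam mu (c + 1) k = 0 → excess lam mu c k = 0 := by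
      intro k hky hk
      have h1 := excess_succ h c k
      rcases canonicalStar_mem h k c with h2 | h2 | h2
      · exact absurd (neg_one_unique h h2 hy) hky
      · omega
      · have := excess_pos_of_eq_one h h2
        omega
    rcases canonicalStar_mem h v.row c with h1 | h1 | h1
    · have := excess_eq_zero h h1
      omega
    · -- Column `c` does not touch the row of `v`.
      refine ⟨v, hwv, hv.entry_eq, (Nat.le_succ _).trans hv.le_col, ?_, fun d hd hdv => ?_,
        hv.row_ne, fun k hk => hsame k ?_ (hv.between k hk)⟩
      · have h2 := excess_succ h c v.row
        have h3 := hv.excess_eq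
        omega
      · rcases hd.eq_or_lt with hd | hd
        · rw [← Fin.ext hd]; exact h1
        · exact hv.eq_zero d hd hdv
      · rintro rfl
        have := eq_one_of_excess_pos h hy hvpos fun l hl => hv.between l (by
          unfold StrictlyBetween at *; omega)
        omega
    · -- Column `c` ends the row of `v`; the path goes on with the `-1` of this column.
      obtain ⟨u, hu1, hu2, hu3⟩ := Vertex.exists_of_eq_one h1
      obtain ⟨v', rfl, hv2, hv3⟩ := Vertex.exists_of_eq_neg_one hy
      refine ⟨v', (hwv.tail (Or.inl (hv.isHorizontalArc hu3 hu1 hu2))).tail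
        (Or.inr ⟨hu3, hv3, hv2.trans hu2.symm⟩), hv3, hv2 ▸ le_rfl,
        excess_eq_one_of_eq_neg_one h hy, fun d hd hdv => ?_, hyw, fun k hk => ?_⟩
      · rw [hv2, Fin.lt_def] at hdv; omega
      · by_cases hkv : k = v.row
        · have h2 := excess_succ h c v.row
          have h3 := hv.excess_eq
          rw [hkv]
          omega
        by_cases hkb : StrictlyBetween v.row w.row k
        · refine hsame k ?_ (hv.between k hkb)
          rintro rfl
          rcases hk with ⟨h2, -⟩ | ⟨-, h2⟩ <;> exact absurd h2 (lt_irrefl _)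
        · refine (excess_eq_zero_of_strictlyBetween h hy h1 ?_).2
          have := hv.row_ne
          unfold StrictlyBetween at *
          omega

/-- This is where the planarity of the graph enters: the path from the first `1` to the right of a
`-1` leads to this `-1`. -/
lemma reflTransGen_of_nearest (h : IsKostkaPair lam mu) {w t : Vertex lam mu} (ht : t.entry = -1)
    (hw : w.entry = 1) (hrow : w.row = t.row) (hcol : t.col < w.col)
    (hmin : ∀ u : Vertex lam mu, u.entry = 1 → u.row = t.row → t.col < u.col → w.col ≤ u.col)
    (hneg : ∀ c, t.col < c → ∃ y, canonicalStar lam mu y c = -1) :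
    ReflTransGen (kgrGraph lam mu).Adj w t := by
  have hno : ∀ c, t.col < c → c < w.col → canonicalStar lam mu t.row c ≠ 1 := by
    intro c hc hcw h1
    obtain ⟨u, hu1, rfl, hu3⟩ := Vertex.exists_of_eq_one h1
    exact absurd (hmin u hu3 hu1 hc) (not_le.2 hcw)
  have hex : ∀ j : ℕ, t.col < j → j ≤ w.col → excess lam mu j t.row = 0 := by
    intro j hj hjw
    have h1 := excess_le_of_forall_ne_one h (x := t.row) (Nat.succ_le_of_lt hj)
      (hjw.trans w.col.2.le) fun c hc hcj => hno c hc (Fin.lt_def.2 (by omega))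
    have h2 := excess_nonneg h j t.row
    have h3 := excess_eq_zero h ht
    rw [Nat.succ_eq_add_one] at h1
    omega
  have hzero : ∀ c, t.col < c → c < w.col → canonicalStar lam mu w.row c = 0 := by
    intro c hc hcw
    have hc' : (t.col : ℕ) < c := hc
    have h1 := excess_succ h c t.row
    rw [hex c hc hcw.le, hex (c + 1) (by omega) hcw] at h1
    rw [hrow]
    omega
  obtain ⟨v, hwv, hv⟩ := exists_isNearest h hw hneg hzero (Nat.lt_succ_self _) hcol
  rw [hrow] at hv
  have h1 := eq_one_of_excess_pos h ht (by rw [hv.excess_eq]; decide) hv.between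
  obtain ⟨u, hu1, hu2, hu3⟩ := Vertex.exists_of_eq_one h1
  exact (hwv.tail (Or.inl (hv.isHorizontalArc hu3 hu1 hu2))).tail (Or.inr ⟨hu3, ht, hu2.symm⟩)

/-! ### A decomposition yields a conservative subtree -/

/-- A rank that decreases along every arc. -/
def arcRank (u : Vertex lam mu) : ℤ := 3 * (u.col : ℕ) + u.entry

lemma arcRank_lt_of_adj {u v : Vertex lam mu} (huv : (kgrGraph lam mu).Adj u v) :
    arcRank v < arcRank u := by
  unfold arcRank
  rcases huv with ⟨h1, h2, -, h3, -⟩ | ⟨h1, h2, h3⟩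
  · rw [Fin.lt_def] at h3; omega
  · rw [h3]; omega

lemma arcRank_lt_of_transGen {u v : Vertex lam mu}
    (huv : TransGen (kgrGraph lam mu).Adj u v) : arcRank v < arcRank u := by
  induction huv with
  | single h => exact arcRank_lt_of_adj h
  | tail _ h ih => exact (arcRank_lt_of_adj h).trans ih

lemma arcRank_le_of_reflTransGen {u v : Vertex lam mu}
    (huv : ReflTransGen (kgrGraph lam mu).Adj u v) : arcRank v ≤ arcRank u := by
  rcases reflTransGen_iff_eq_or_transGen.1 huv with rfl | h
  · exact le_rfl
  · exact (arcRank_lt_of_transGen h).le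

/-- The vertices from which there is a path to `t` but no nontrivial path to `w`, with all the arcs
of the graph between them: the branch of the tree above `t`, with the part above `w` cut off. -/
def subtreeBetween (w t : Vertex lam mu) : DiSubgraph (kgrGraph lam mu) where
  verts := {v | ReflTransGen (kgrGraph lam mu).Adj v t ∧ ¬ TransGen (kgrGraph lam mu).Adj v w}
  Adj u v := (kgrGraph lam mu).Adj u v ∧
    (ReflTransGen (kgrGraph lam mu).Adj u t ∧ ¬ TransGen (kgrGraph lam mu).Adj u w) ∧
    (ReflTransGen (kgrGraph lam mu).Adj v t ∧ ¬ TransGen (kgrGraph lam mu).Adj v w)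
  adj_sub h := h.1
  left_mem h := h.2.1
  right_mem h := h.2.2

lemma subtreeBetween_adj {w t u v : Vertex lam mu} (huv : (kgrGraph lam mu).Adj u v)
    (hu : u ∈ (subtreeBetween w t).verts) (hv : v ∈ (subtreeBetween w t).verts) :
    (subtreeBetween w t).Adj u v := ⟨huv, hu, hv⟩

/-- A vertex of the subtree other than `t` has its outgoing arc in the subtree. -/
lemma exists_adj_of_mem_subtreeBetween {w t v : Vertex lam mu}
    (hv : v ∈ (subtreeBetween w t).verts) (hvt : v ≠ t) :
    ∃ v', (subtreeBetween w t).Adj v v' := by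
  obtain ⟨h1, h2⟩ := hv
  rcases ReflTransGen.cases_head h1 with h3 | ⟨v', h3, h4⟩
  · exact absurd h3 hvt
  · exact ⟨v', h3, ⟨h1, h2⟩, h4, fun h5 => h2 (TransGen.head h3 h5)⟩

lemma subtreeBetween_isConnected {w t : Vertex lam mu} (ht : t ∈ (subtreeBetween w t).verts) :
    (subtreeBetween w t).IsConnected := by
  have key : ∀ v, ReflTransGen (kgrGraph lam mu).Adj v t →
      ∀ hv : v ∈ (subtreeBetween w t).verts,
      (subtreeBetween w t).toDigraph.toSimpleGraphInclusive.Reachable ⟨v, hv⟩ ⟨t, ht⟩ := by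
    intro v hvt
    induction hvt using ReflTransGen.head_induction_on with
    | refl => exact fun _ => SimpleGraph.Reachable.refl _
    | head hadj hvt ih =>
      intro hv
      have hv' : _ ∈ (subtreeBetween w t).verts :=
        ⟨hvt, fun h5 => hv.2 (TransGen.head hadj h5)⟩
      refine SimpleGraph.Reachable.trans (SimpleGraph.Adj.reachable ?_) (ih hv')
      refine (SimpleGraph.fromRel_adj _ _ _).2 ⟨fun he => ?_,
        Or.inl (subtreeBetween_adj hadj hv hv')⟩
      have h1 := arcRank_lt_of_adj hadj
      exact h1.ne (congrArg (fun y => arcRank y.1) he).symm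
  have : Nonempty (subtreeBetween w t).verts := ⟨⟨t, ht⟩⟩
  exact ⟨fun u v => (key u.1 u.2.1 u.2).trans (key v.1 v.2.1 v.2).symm⟩

lemma subtreeBetween_isConservativeSubtree (h : IsKostkaPair lam mu) {w t : Vertex lam mu}
    (ht : t.entry = -1) (hw : w.entry = 1) (hrow : w.row = t.row)
    (hwt : ReflTransGen (kgrGraph lam mu).Adj w t) :
    IsConservativeSubtree (subtreeBetween w t) := by
  have htw : t ≠ w := by rintro rfl; rw [ht] at hw; exact absurd hw (by decide)
  have hmemt : t ∈ (subtreeBetween w t).verts := by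
    refine ⟨.refl, fun h1 => ?_⟩
    exact absurd (arcRank_lt_of_transGen h1) (not_lt.2 (arcRank_le_of_reflTransGen hwt))
  have hmemw : w ∈ (subtreeBetween w t).verts :=
    ⟨hwt, fun h1 => lt_irrefl _ (arcRank_lt_of_transGen h1)⟩
  -- Out-degrees are at most one, so every path that leads from `a` further than `b` goes on
  -- from `b`.
  have hnext : ∀ a b, (kgrGraph lam mu).Adj a b → b ≠ w →
      TransGen (kgrGraph lam mu).Adj a w → TransGen (kgrGraph lam mu).Adj b w := by
    intro a b hab hbw haw
    obtain ⟨b', hab', hb'w⟩ := TransGen.head'_iff.1 haw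
    rw [← adj_right_unique h hab hab'] at hb'w
    rcases reflTransGen_iff_eq_or_transGen.1 hb'w with h1 | h1
    · exact absurd h1.symm hbw
    · exact h1
  obtain ⟨z, hz⟩ := exists_horizontalArc h ht
  refine ⟨subtreeBetween_isConnected hmemt, fun hwhole => ?_, fun a b c d hab hab' hcd hca => ?_,
    Or.inr ⟨⟨t, hmemt⟩, fun y hy => ?_, fun t' ht' => ?_, ht, ⟨w, hmemw⟩, fun y hy => ?_, hw, hrow,
    fun v hv hvw x hx => ?_⟩⟩
  · have h1 : z ∈ (subtreeBetween w t).verts := hwhole.1 ▸ Set.mem_univ z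
    exact absurd (arcRank_le_of_reflTransGen h1.1) (not_le.2 (arcRank_lt_of_adj (Or.inl hz)))
  · have hdb : d = b := Vertex.eq_of_entry_eq_neg_one h hcd.2.1 hab'.2.1
      (by rw [hcd.2.2, hca, hab'.2.2])
    subst hdb
    have hd := (subtreeBetween w t).right_mem hab
    have hdw : d ≠ w := by rintro rfl; rw [hcd.2.1] at hw; exact absurd hw (by decide)
    exact subtreeBetween_adj (Or.inr hcd)
      ⟨hd.1.head (Or.inr hcd), fun h1 => hd.2 (hnext c d (Or.inr hcd) hdw h1)⟩ hd
  · exact absurd (arcRank_le_of_reflTransGen y.2.1) (not_le.2 (arcRank_lt_of_adj hy.1))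
  · by_contra hne
    obtain ⟨v, hv⟩ := exists_adj_of_mem_subtreeBetween t'.2 fun he => hne (Subtype.ext he)
    exact ht' ⟨v, (subtreeBetween w t).right_mem hv⟩ hv
  · exact y.2.2 (TransGen.single hy.1)
  · have hvw' : v.1 ≠ w := fun he => hvw (Subtype.ext he)
    have hxm : x ∈ (subtreeBetween w t).verts :=
      ⟨v.2.1.head hx, fun h1 => v.2.2 (hnext x v hx hvw' h1)⟩
    exact hv ⟨x, hxm⟩ (subtreeBetween_adj hx hxm v.2)

/-- The subgraph of a digraph on a connected component. -/
def componentSubgraph {V : Type*} {G : Digraph V}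
    (C : G.toSimpleGraphInclusive.ConnectedComponent) : DiSubgraph G where
  verts := C.supp
  Adj u v := G.Adj u v ∧ u ∈ C.supp ∧ v ∈ C.supp
  adj_sub h := h.1
  left_mem h := h.2.1
  right_mem h := h.2.2

lemma componentSubgraph_isConnected {V : Type*} {G : Digraph V}
    (C : G.toSimpleGraphInclusive.ConnectedComponent) : (componentSubgraph C).IsConnected := by
  refine C.connected_toSimpleGraph.mono ?_
  intro u v huv
  obtain ⟨h1, h2⟩ := (SimpleGraph.fromRel_adj _ _ _).1 huv
  refine (SimpleGraph.fromRel_adj _ _ _).2 ⟨fun he => h1 (congrArg Subtype.val he), ?_⟩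
  exact h2.imp (fun h3 => ⟨h3, u.2, v.2⟩) fun h3 => ⟨h3, v.2, u.2⟩

/-- A component of a disconnected graph is a conservative subtree. -/
lemma exists_isConservativeSubtree_of_not_preconnected (h : IsKostkaPair lam mu)
    (hconn : ¬ (kgrGraph lam mu).toSimpleGraphInclusive.Preconnected) :
    ∃ H : DiSubgraph (kgrGraph lam mu), IsConservativeSubtree H := by
  unfold SimpleGraph.Preconnected at hconn
  push Not at hconn
  obtain ⟨u, v, huv⟩ := hconn
  set C := (kgrGraph lam mu).toSimpleGraphInclusive.connectedComponentMk u with hC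
  refine ⟨componentSubgraph C, componentSubgraph_isConnected C, fun hwhole => huv ?_,
    fun a b c d hab _ hcd hca => ?_, Or.inl ⟨C, rfl, fun x hx y hy hxy => ⟨hxy, hx, hy⟩⟩⟩
  · have hv : v ∈ C.supp := by
      have : v ∈ (componentSubgraph C).verts := hwhole.1 ▸ Set.mem_univ v
      exact this
    exact (SimpleGraph.ConnectedComponent.exact hv).symm
  · have ha : a ∈ C.supp := hab.2.1
    have key : ∀ e : Vertex lam mu, e.col = a.col → e ∈ C.supp := fun e he =>
      (SimpleGraph.ConnectedComponent.sound (reachable_of_col_eq h he)).trans ha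
    exact ⟨Or.inr hcd, key c hca, key d (hcd.2.2.trans hca)⟩

/-- In a connected graph, every vertex has a path to any given sink. -/
lemma reflTransGen_of_isSink (h : IsKostkaPair lam mu)
    {u y : Vertex lam mu} (hy : IsSink (kgrGraph lam mu) y)
    (hu : (kgrGraph lam mu).toSimpleGraphInclusive.Reachable y u) :
    ReflTransGen (kgrGraph lam mu).Adj u y := by
  rw [SimpleGraph.reachable_iff_reflTransGen] at hu
  induction hu with
  | refl => exact .refl
  | @tail a b _ hab ih =>
    rcases ((SimpleGraph.fromRel_adj _ _ _).1 hab).2 with h1 | h1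
    · rcases ReflTransGen.cases_head ih with rfl | ⟨b', h2, h3⟩
      · exact absurd h1 (hy b)
      · rwa [adj_right_unique h h1 h2]
    · exact ih.head h1

/-- If no `1` lies to the right of a `-1` in the same row, a row with a `-1` consists of this `-1` and
its partner only, so a decomposition does not separate them. -/
lemma col_mem_iff_of_isHorizontalArc (h : IsKostkaPair lam mu)
    (hno : ∀ t w : Vertex lam mu, t.entry = -1 → w.entry = 1 → w.row = t.row → w.col ≤ t.col)
    {S : Finset (Fin (firstPart lam))} (hS : ∀ x, 0 ≤ ∑ c ∈ S, canonicalStar lam mu x c)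
    (hSc : ∀ x, 0 ≤ ∑ c ∈ Sᶜ, canonicalStar lam mu x c) {t z : Vertex lam mu}
    (htz : IsHorizontalArc t z) : t.col ∈ S ↔ z.col ∈ S := by
  have ht : canonicalStar lam mu t.row t.col = -1 := htz.1
  have hz : canonicalStar lam mu t.row z.col = 1 := by
    rw [← htz.2.2.1]; exact htz.2.1
  have hzt : z.col < t.col := htz.2.2.2.1
  have hzt' : (z.col : ℕ) < t.col := hzt
  have hright : ∀ c, t.col < c → canonicalStar lam mu t.row c ≠ 1 := by
    intro c hc h1
    obtain ⟨w, hw1, rfl, hw3⟩ := Vertex.exists_of_eq_one h1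
    exact absurd (hno t w htz.1 hw3 hw1) (not_le.2 hc)
  have hleft : ∀ c, c < z.col → canonicalStar lam mu t.row c ≠ -1 := by
    intro c hc h1
    obtain ⟨t', ht1, rfl, ht3⟩ := Vertex.exists_of_eq_neg_one h1
    exact absurd (hno t' z ht3 htz.2.1 (htz.2.2.1.trans ht1.symm)) (not_le.2 hc)
  -- The excess is zero before column `z.col`, one from there to column `t.col`, and zero from
  -- there on.
  have hzero : ∀ c, c ≠ t.col → c ≠ z.col → canonicalStar lam mu t.row c = 0 := by
    have hmid : ∀ c, z.col < c → c < t.col → canonicalStar lam mu t.row c = 0 := by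
      intro c hzc hct
      have hno1 : ∀ d, z.col < d → d < t.col → canonicalStar lam mu t.row d ≠ 1 := by
        intro d hzd hdt h1
        obtain ⟨w, hw1, rfl, hw3⟩ := Vertex.exists_of_eq_one h1
        exact absurd (htz.2.2.2.2 w hw3 hw1 hdt) (not_le.2 hzd)
      refine ((canonicalStar_mem h t.row c).resolve_left fun h1 => ?_).resolve_right
        (hno1 c hzc hct)
      have h2 := excess_le_of_forall_ne_one h (x := t.row) (Nat.succ_le_of_lt hct) t.col.2.le
        fun d hd hdt => hno1 d (hzc.trans (Fin.lt_def.2 hd)) (Fin.lt_def.2 hdt)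
      rw [Nat.succ_eq_add_one, excess_eq_zero h h1, excess_eq_one_of_eq_neg_one h ht] at h2
      omega
    intro c hct hcz
    rcases lt_or_gt_of_ne hct with hct | hct
    · rcases lt_or_gt_of_ne hcz with hcz | hcz
      · refine ((canonicalStar_mem h t.row c).resolve_left (hleft c hcz)).resolve_right
          fun h1 => ?_
        have h2 := le_excess_of_forall_ne_neg_one h (x := t.row) (Nat.succ_le_of_lt hcz)
          z.col.2.le fun d _ hd => hleft d (Fin.lt_def.2 hd)
        have h3 := excess_pos_of_eq_one h h1
        have h4 := excess_succ h z.col t.row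
        have h5 := le_excess_of_forall_ne_neg_one h (x := t.row) (Nat.succ_le_of_lt hzt)
          t.col.2.le fun d hd hdt h6 => by
            rw [hmid d (Fin.lt_def.2 hd) (Fin.lt_def.2 hdt)] at h6
            exact absurd h6 (by decide)
        rw [excess_eq_one_of_eq_neg_one h ht] at h5
        rw [Nat.succ_eq_add_one] at h2 h5
        omega
      · exact hmid c hcz hct
    · have hex : ∀ j : ℕ, t.col < j → j ≤ firstPart lam → excess lam mu j t.row = 0 := by
        intro j hj hjs
        have h1 := excess_le_of_forall_ne_one h (x := t.row) (Nat.succ_le_of_lt hj) hjs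
          fun d hd _ => hright d (Fin.lt_def.2 hd)
        have h2 := excess_nonneg h j t.row
        rw [Nat.succ_eq_add_one, excess_eq_zero h ht] at h1
        omega
      have hct' : (t.col : ℕ) < c := hct
      have h1 := excess_succ h c t.row
      rw [hex c hct c.2.le, hex (c + 1) (by omega) c.2] at h1
      omega
  have hsum : ∀ T : Finset (Fin (firstPart lam)), t.col ∈ T → z.col ∉ T →
      ∑ c ∈ T, canonicalStar lam mu t.row c = -1 := by
    intro T h1 h2
    rw [Finset.sum_eq_single_of_mem t.col h1 fun c hc hct =>
      hzero c hct fun he => h2 (he ▸ hc), ht]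
  constructor
  · intro h1
    by_contra h2
    have := hS t.row
    rw [hsum S h1 h2] at this
    omega
  · intro h2
    by_contra h1
    have := hSc t.row
    rw [hsum Sᶜ (Finset.mem_compl.2 h1) fun h3 => Finset.mem_compl.1 h3 h2] at this
    omega

lemma exists_isConservativeSubtree_of_isReducible (h : IsKostkaPair lam mu)
    (hred : IsReducible (canonicalMatrix lam mu)) :
    ∃ H : DiSubgraph (kgrGraph lam mu), IsConservativeSubtree H := by
  by_cases hconn : (kgrGraph lam mu).toSimpleGraphInclusive.Preconnected
  swap
  · exact exists_isConservativeSubtree_of_not_preconnected h hconn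
  by_cases hno : ∀ t w : Vertex lam mu, t.entry = -1 → w.entry = 1 → w.row = t.row →
      w.col ≤ t.col
  · -- The columns of the decomposition are unions of components.
    exfalso
    obtain ⟨S, ⟨c, hc⟩, hne, hS, hSc⟩ := hred
    have harc : ∀ u v, (kgrGraph lam mu).Adj u v → (u.col ∈ S ↔ v.col ∈ S) := by
      rintro u v (huv | huv)
      · exact col_mem_iff_of_isHorizontalArc h hno (sum_starMatrix_nonneg hS)
          (sum_starMatrix_nonneg hSc) huv
      · rw [huv.2.2]
    obtain ⟨d, hd⟩ : ∃ d, d ∉ S := by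
      by_contra! hall
      exact hne (Finset.eq_univ_of_forall hall)
    obtain ⟨x, hx⟩ := exists_canonicalStar_eq_one h c
    obtain ⟨u, -, rfl, -⟩ := Vertex.exists_of_eq_one hx
    obtain ⟨y, hy⟩ := exists_canonicalStar_eq_one h d
    obtain ⟨v, -, rfl, -⟩ := Vertex.exists_of_eq_one hy
    have huv := hconn u v
    rw [SimpleGraph.reachable_iff_reflTransGen] at huv
    refine hd ?_
    clear hd hy
    induction huv with
    | refl => exact hc
    | tail _ hab ih =>
      rcases ((SimpleGraph.fromRel_adj _ _ _).1 hab).2 with h1 | h1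
      · exact (harc _ _ h1).1 ih
      · exact (harc _ _ h1).2 ih
  · push Not at hno
    obtain ⟨t, w₀, ht, hw₀, hrow₀, hcol₀⟩ := hno
    obtain ⟨w, hw, hmin⟩ := Finset.exists_min_image
      (Finset.univ.filter fun w : Vertex lam mu => w.entry = 1 ∧ w.row = t.row ∧ t.col < w.col)
      Vertex.col ⟨w₀, by simp [hw₀, hrow₀, hcol₀]⟩
    simp only [Finset.mem_filter, Finset.mem_univ, true_and] at hw hmin
    obtain ⟨hw1, hw2, hw3⟩ := hw
    refine ⟨_, subtreeBetween_isConservativeSubtree h ht hw1 hw2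
      (reflTransGen_of_nearest h ht hw1 hw2 hw3 (fun u h1 h2 h3 => hmin u ⟨h1, h2, h3⟩) ?_)⟩
    -- A column without `-1` holds a sink, to which there is a path from `t`.
    intro c hc
    by_contra! hcol
    obtain ⟨y, hy⟩ := exists_canonicalStar_eq_one h c
    obtain ⟨u, -, rfl, hu3⟩ := Vertex.exists_of_eq_one hy
    have hsink : IsSink (kgrGraph lam mu) u := by
      intro v huv
      have h1 := isVerticalArc_of_adj hu3 huv
      exact hcol v.row (h1.2.2 ▸ h1.2.1)
    have h1 := arcRank_le_of_reflTransGen (reflTransGen_of_isSink h hsink (hconn u t))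
    unfold arcRank at h1
    rw [Fin.lt_def] at hc
    omega

end

end KGR

theorem theorem3p6 {r : ℕ} (lam mu : Fin r → ℕ) (h : KGR.IsKostkaPair lam mu) :
    KGR.IsReducible (KGR.canonicalMatrix lam mu) ↔
      ∃ H : KGR.DiSubgraph (KGR.kgrGraph lam mu), KGR.IsConservativeSubtree H := by
  refine ⟨KGR.exists_isConservativeSubtree_of_isReducible h, ?_⟩
  rintro ⟨H, hconn, hproper, hvert, hcomp | hsink⟩
  · exact KGR.isReducible_of_isComponent h hconn hproper hcomp
  · exact KGR.isReducible_of_sinkSourceCondition h hvert hsink
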